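/- Let $\mathcal X$ be a finite or countably infinite set, let $K$ be an irreducible Markov kernel on $\mathcal X$ (so $K(x,y)\ge 0$ and $\sum_y K(x,y)=1$ for all $x$), and let $\pi$ be a probability measure on $\mathcal X$ that is reversible for $K$: $K(x,y)\pi(x)=K(y,x)\pi(y)$ for all $x,y$. Put $J:=\sup_x(1-K(x,x))$, and let $d$ be the graph distance of $K$: $d(x,y)$ is the least $n$ for which there are $x=x_0,\dots,x_n=y$ with $K(x_i,x_{i+1})>0$ for all $i<n$. For functions $f,g$ on $\mathcal X$ let $$Lf(x)=\sum_y (f(y)-f(x))K(x,y),\qquad \Gamma(f,g)(x)=\tfrac12\sum_y (f(y)-f(x))(g(y)-g(x))K(x,y),$$ $\Gamma(f)=\Gamma(f,f)$, $\Gamma_2(f)=\tfrac12L\Gamma(f)-\Gamma(f,Lf)$ and $\widetilde\Gamma_2(f)=\Gamma_2(f)-\Gamma\big(f,\tfrac{\Gamma(f)}{f}\big)$. Let $\kappa_e>0$ and assume the exponential curvature condition $CDE'(\kappa_e,\infty)$: $\widetilde\Gamma_2(f)(x)\ge\kappa_e\,\Gamma(f)(x)$ for all $x\in\mathcal X$ and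 all functions $f$ on $\mathcal X$ with $0<\inf f\le\sup f<\infty$ (on a finite $\mathcal X$: all positive functions). For probability measures $\nu,\mu$ on $\mathcal X$ let $$\widetilde W_2(\nu|\mu)^2:=\inf_{X\sim\nu,\;Y\sim\mu}\mathbb E\Big[\big(\mathbb E[d(X,Y)\,|\,X]\big)^2\Big]\in[0,\infty]$$ be Marton's weak transport cost, where the infimum runs over all couplings $(X,Y)$ of $\nu$ and $\mu$, and for $f\ge0$ let $$\mathcal I_\pi(f):=4\int\Gamma(\sqrt f)\,d\pi .$$ Then for every $f\ge 0$ with $\int f\,d\pi=1$, $$\widetilde W_2(f\pi|\pi)^2\le\frac{2J}{\kappa_e^2}\,\mathcal I_\pi(f)\le\frac{2}{\kappa_e^2}\,\mathcal I_\pi(f).$$ In particular $\pi$ satisfies the weak transport-information inequality $\widetilde W_2(f\pi|\pi)^2\le\frac1{C^2}\mathcal I_\pi(f)$, for all probability measures $f\pi$, with the constant $C=\kappa_e/\sqrt2$. -/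

import Mathlib

open scoped ENNReal

namespace WeakTransport

variable {X : Type*}

/-- There is a path `x = x₀, …, xₙ = y` of length `n` all of whose steps are charged by `K`. -/
def HasPath (K : X → X → ℝ) (n : ℕ) (x y : X) : Prop :=
  ∃ c : ℕ → X, c 0 = x ∧ c n = y ∧ ∀ i < n, 0 < K (c i) (c (i + 1))

/-- `K` is an irreducible Markov kernel on the discrete space `X`, and `π` is a probability
measure (given by its weights) which is reversible for `K`. -/
structure IsReversibleChain (K : X → X → ℝ) (π : X → ℝ) : Prop where
  kernel_nonneg : ∀ x y, 0 ≤ K x y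
  kernel_sum : ∀ x, HasSum (K x) 1
  irreducible : ∀ x y, ∃ n, HasPath K n x y
  prob_nonneg : ∀ x, 0 ≤ π x
  prob_sum : HasSum π 1
  detailed_balance : ∀ x y, K x y * π x = K y x * π y

/-- The graph distance: the least length of a path charged by `K`. -/
noncomputable def graphDist (K : X → X → ℝ) (x y : X) : ℕ :=
  sInf {n : ℕ | HasPath K n x y}

/-- `J = sup_x (1 - K(x,x))`. -/
noncomputable def laziness (K : X → X → ℝ) : ℝ :=
  ⨆ x, (1 - K x x)

/-- The generator `L f (x) = ∑_y (f y - f x) K(x,y)`. -/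
noncomputable def gen (K : X → X → ℝ) (f : X → ℝ) (x : X) : ℝ :=
  ∑' y, (f y - f x) * K x y

/-- `Γ(f,g)(x) = ½ ∑_y (f y - f x)(g y - g x) K(x,y)`. -/
noncomputable def Gam (K : X → X → ℝ) (f g : X → ℝ) (x : X) : ℝ :=
  (1 / 2) * ∑' y, (f y - f x) * (g y - g x) * K x y

/-- `Γ₂(f) = ½ L Γ(f) - Γ(f, L f)`. -/
noncomputable def Gam2 (K : X → X → ℝ) (f : X → ℝ) (x : X) : ℝ :=
  (1 / 2) * gen K (Gam K f f) x - Gam K f (gen K f) x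

/-- The modified operator `Γ₂(f) - Γ(f, Γ(f)/f)`. -/
noncomputable def modGam2 (K : X → X → ℝ) (f : X → ℝ) (x : X) : ℝ :=
  Gam2 K f x - Gam K f (fun z => Gam K f f z / f z) x

/-- The exponential curvature condition `CDE'(κ,∞)`. The quotient `Γ(f)/f` requires `f > 0`.
The test functions are those with `0 < a ≤ f ≤ b` for some constants `a`, `b`: on a finite space
these are all the positive functions, and on an infinite one every sum above converges absolutely
for them. (Asking the inequality for more functions would only be a stronger condition.) -/
def CDEprime (K : X → X → ℝ) (κ : ℝ) : Prop :=
  ∀ f : X → ℝ, (∃ a, 0 < a ∧ ∀ x, a ≤ f x) → (∃ b, ∀ x, f x ≤ b) →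
    ∀ x, κ * Gam K f f x ≤ modGam2 K f x

/-- The Fisher information `I_π(f) = 4 ∫ Γ(√f) dπ`. -/
noncomputable def fisherInfo (K : X → X → ℝ) (π : X → ℝ) (f : X → ℝ) : ℝ :=
  4 * ∑' x, Gam K (fun z => √(f z)) (fun z => √(f z)) x * π x

/-- `f` is a probability density with respect to `π`, i.e. `f π` is a probability measure. -/
structure IsDensity (π : X → ℝ) (f : X → ℝ) : Prop where
  nonneg : ∀ x, 0 ≤ f x
  sum : HasSum (fun x => f x * π x) 1

/-- `q` is a coupling of `ν` (first marginal) and `μ` (second marginal). -/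
structure IsCoupling (ν μ : X → ℝ) (q : X → X → ℝ) : Prop where
  nonneg : ∀ x y, 0 ≤ q x y
  fst : ∀ x, HasSum (fun y => q x y) (ν x)
  snd : ∀ y, HasSum (fun x => q x y) (μ y)

/-- `p` is a probability kernel with `q(dx dy) = p_x(dy) ν(dx)`. -/
structure IsDisintegration (ν : X → ℝ) (q p : X → X → ℝ) : Prop where
  nonneg : ∀ x y, 0 ≤ p x y
  sum : ∀ x, HasSum (p x) 1
  eq_mul : ∀ x y, q x y = p x y * ν x

/-- Marton's weak transport cost of `ν` given `μ` for the distance `d`: the infimum over the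
couplings `(X, Y)` of `ν` and `μ` of `E[(E[d(X,Y) | X])²]`, where `X` has law `ν` and `Y` law `μ`.
It is `[0,∞]`-valued. -/
noncomputable def weakCost (d : X → X → ℕ) (ν μ : X → ℝ) : ℝ≥0∞ :=
  ⨅ (q : X → X → ℝ) (p : X → X → ℝ) (_ : IsCoupling ν μ q) (_ : IsDisintegration ν q p),
    ∑' x, (∑' y, (d x y : ℝ≥0∞) * ENNReal.ofReal (p x y)) ^ 2 * ENNReal.ofReal (ν x)

/-- The weak Wasserstein-like quantity `W̃₂(ν|μ)`, the square root of the weak transport cost. -/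
noncomputable def weakW2 (d : X → X → ℕ) (ν μ : X → ℝ) : ℝ≥0∞ :=
  weakCost d ν μ ^ (1 / 2 : ℝ)

/-- The weak transport-information inequality with constant `C`, for the graph distance:
`W̃₂(fπ|π)² ≤ C⁻² I_π(f)` for all probability measures `fπ`. -/
def WeakTransportInfo (K : X → X → ℝ) (π : X → ℝ) (C : ℝ) : Prop :=
  ∀ f : X → ℝ, IsDensity π f →
    weakW2 (graphDist K) (fun x => f x * π x) π ^ 2
      ≤ ENNReal.ofReal (1 / C ^ 2 * fisherInfo K π f)

end WeakTransport

/-! Along the heat flow `f_t`, with `u = √f_t`, the time derivative of `u` is `L(u²)/(2u) = Lu +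
Γ(u)/u`. Hence the modified `Γ₂` of `u` equals `½LΓ(u) − Γ(u, L(u²)/(2u))`; since `∫ LΓ(u) dπ = 0`,
the curvature condition makes `E(u) = ∫ Γ(u) dπ` decay like `exp(-2κt)`. On the other hand, moving
`f_t π` to `f_{t+h} π` costs at most about `h √(4 J E(u))`, because mass only has to follow the net
current across edges. The triangle inequality and integration in time give `W̃₂ ≤ κ⁻¹ √(4 J E(√f))`,
where `4 E(√f)` is the Fisher information.

The semigroup is replaced by the explicit Euler scheme `f ↦ f + h L f` with a fixed small step, for
densities bounded above and below. The two estimates become `energy_sqrt_euler_le` and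
`weakW2_euler_le`, chained by `weakW2_triangle` into a geometric series. The fixed step loses a
factor `4/3`, which is affordable because `(4/3)² ≤ 2`.

The chain must end at `π`, so the cost from the iterates to `π` has to vanish. This rests on a
finite diameter (`exists_graphDist_le`): linearising the curvature condition at constants gives the
Bakry-Émery condition, under which the Euler scheme flattens a truncated distance function while
displacing it by a bounded amount. With bounded distance the cost is controlled by total variation
(`weakW2_le_of_bounded`). The same control removes the bounds on `f`, by truncating `√f`
(`weakW2_le_energy`). -/

namespace WeakTransport

open Filter
open scoped Topology

/-! ### Bounded functions and weighted sums -/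

section WeightedSums

variable {ι : Type*}

/-- `F` is a bounded real function. -/
def Bdd (F : ι → ℝ) : Prop := ∃ C, ∀ i, |F i| ≤ C

theorem Bdd.exists_pos {F : ι → ℝ} (hF : Bdd F) : ∃ C, 0 < C ∧ ∀ i, |F i| ≤ C := by
  obtain ⟨C, hC⟩ := hF
  exact ⟨max C 1, by positivity, fun i => (hC i).trans (le_max_left _ _)⟩

theorem Bdd.const (c : ℝ) : Bdd (fun _ : ι => c) := ⟨|c|, fun _ => le_rfl⟩

theorem Bdd.of_mem_Icc {F : ι → ℝ} {a b : ℝ} (h : ∀ i, F i ∈ Set.Icc a b) : Bdd F :=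
  ⟨max |a| |b|, fun i => abs_le_max_abs_abs (h i).1 (h i).2⟩

theorem Bdd.add {F G : ι → ℝ} (hF : Bdd F) (hG : Bdd G) : Bdd (fun i => F i + G i) := by
  obtain ⟨C, hC⟩ := hF
  obtain ⟨D, hD⟩ := hG
  exact ⟨C + D, fun i => (abs_add_le _ _).trans (add_le_add (hC i) (hD i))⟩

theorem Bdd.sub {F G : ι → ℝ} (hF : Bdd F) (hG : Bdd G) : Bdd (fun i => F i - G i) := by
  obtain ⟨C, hC⟩ := hF
  obtain ⟨D, hD⟩ := hG
  exact ⟨C + D, fun i => (abs_sub _ _).trans (add_le_add (hC i) (hD i))⟩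

theorem Bdd.mul {F G : ι → ℝ} (hF : Bdd F) (hG : Bdd G) : Bdd (fun i => F i * G i) := by
  obtain ⟨C, hC0, hC⟩ := hF.exists_pos
  obtain ⟨D, hD⟩ := hG
  refine ⟨C * D, fun i => ?_⟩
  rw [abs_mul]
  exact mul_le_mul (hC i) (hD i) (abs_nonneg _) hC0.le

theorem Bdd.sq {F : ι → ℝ} (hF : Bdd F) : Bdd (fun i => F i ^ 2) := by
  simpa only [pow_two] using hF.mul hF

theorem Bdd.inv {F : ι → ℝ} {a : ℝ} (ha : 0 < a) (h : ∀ i, a ≤ F i) : Bdd (fun i => (F i)⁻¹) := by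
  refine ⟨a⁻¹, fun i => ?_⟩
  rw [abs_of_pos (inv_pos.2 (ha.trans_le (h i)))]
  exact inv_anti₀ ha (h i)

theorem Bdd.div {F G : ι → ℝ} {a : ℝ} (hG : Bdd G) (ha : 0 < a) (h : ∀ i, a ≤ F i) :
    Bdd (fun i => G i / F i) := by
  simpa only [div_eq_mul_inv] using hG.mul (Bdd.inv ha h)

theorem Bdd.comp {κ : Type*} {F : ι → ℝ} (hF : Bdd F) (e : κ → ι) : Bdd (fun k => F (e k)) := by
  obtain ⟨C, hC⟩ := hF
  exact ⟨C, fun k => hC _⟩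

theorem Bdd.max_zero {F : ι → ℝ} (hF : Bdd F) : Bdd (fun i => max (F i) 0) := by
  obtain ⟨C, hC⟩ := hF
  refine ⟨C, fun i => ?_⟩
  rw [abs_of_nonneg (le_max_right _ _)]
  exact max_le ((le_abs_self _).trans (hC i)) ((abs_nonneg _).trans (hC i))

/-- A nonnegative summable family of weights. -/
structure IsWeight (w : ι → ℝ) : Prop where
  nonneg : ∀ i, 0 ≤ w i
  summable : Summable w

/-- The weighted sum `∑ F w`. -/
noncomputable def wsum (w : ι → ℝ) (F : ι → ℝ) : ℝ := ∑' i, F i * w i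

variable {w : ι → ℝ} {F G : ι → ℝ}

theorem IsWeight.summable_mul (hw : IsWeight w) (hF : Bdd F) : Summable (fun i => F i * w i) := by
  obtain ⟨C, hC⟩ := hF
  refine Summable.of_norm_bounded (hw.summable.mul_left C) fun i => ?_
  rw [Real.norm_eq_abs, abs_mul, abs_of_nonneg (hw.nonneg i)]
  exact mul_le_mul_of_nonneg_right (hC i) (hw.nonneg i)

theorem IsWeight.wsum_add (hw : IsWeight w) (hF : Bdd F) (hG : Bdd G) :
    wsum w (fun i => F i + G i) = wsum w F + wsum w G := by
  unfold wsum
  rw [← (hw.summable_mul hF).tsum_add (hw.summable_mul hG)]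
  simp only [add_mul]

theorem IsWeight.wsum_sub (hw : IsWeight w) (hF : Bdd F) (hG : Bdd G) :
    wsum w (fun i => F i - G i) = wsum w F - wsum w G := by
  unfold wsum
  rw [← (hw.summable_mul hF).tsum_sub (hw.summable_mul hG)]
  simp only [sub_mul]

theorem wsum_const_mul (w F : ι → ℝ) (c : ℝ) : wsum w (fun i => c * F i) = c * wsum w F := by
  unfold wsum
  rw [← tsum_mul_left]
  simp only [mul_assoc]

theorem wsum_const (w : ι → ℝ) (c : ℝ) : wsum w (fun _ => c) = c * ∑' i, w i := by
  unfold wsum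
  rw [tsum_mul_left]

theorem IsWeight.wsum_nonneg (hw : IsWeight w) (h : ∀ i, 0 ≤ F i) : 0 ≤ wsum w F :=
  tsum_nonneg fun i => mul_nonneg (h i) (hw.nonneg i)

theorem IsWeight.wsum_mono (hw : IsWeight w) (hF : Bdd F) (hG : Bdd G) (h : ∀ i, F i ≤ G i) :
    wsum w F ≤ wsum w G :=
  (hw.summable_mul hF).tsum_le_tsum
    (fun i => mul_le_mul_of_nonneg_right (h i) (hw.nonneg i)) (hw.summable_mul hG)

theorem IsWeight.le_wsum (hw : IsWeight w) (hF : Bdd F) (h : ∀ i, 0 ≤ F i) (i : ι) :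
    F i * w i ≤ wsum w F :=
  (hw.summable_mul hF).le_tsum i fun j _ => mul_nonneg (h j) (hw.nonneg j)

/-- The Cauchy-Schwarz inequality. -/
theorem IsWeight.wsum_sq_le (hw : IsWeight w) (hF : Bdd F) :
    wsum w F ^ 2 ≤ (∑' i, w i) * wsum w (fun i => F i ^ 2) := by
  -- This quadratic dominates the nonnegative sum only through `∑ (F - t)² w = (∑ w) t² - 2 t ∑ F w
  -- + ∑ F² w`, to which it is equal; its discriminant is therefore nonpositive.
  have key : ∀ t : ℝ, 0 ≤ (∑' i, w i) * (t * t) + (-2 * wsum w F) * t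
      + wsum w (fun i => F i ^ 2) := by
    intro t
    have h1 : wsum w (fun i => (F i ^ 2 + (-2 * t) * F i) + t ^ 2)
        = (wsum w (fun i => F i ^ 2) + (-2 * t) * wsum w F) + t ^ 2 * ∑' i, w i := by
      rw [hw.wsum_add (hF.sq.add ((Bdd.const _).mul hF)) (Bdd.const _),
        hw.wsum_add hF.sq ((Bdd.const _).mul hF), wsum_const_mul, wsum_const]
    have h2 : 0 ≤ wsum w (fun i => (F i ^ 2 + (-2 * t) * F i) + t ^ 2) :=
      hw.wsum_nonneg fun i => by nlinarith [sq_nonneg (F i - t)]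
    rw [h1] at h2
    linarith
  have := discrim_le_zero key
  unfold discrim at this
  linarith

end WeightedSums

/-! ### The chain -/

variable {X : Type*} {K : X → X → ℝ} {π : X → ℝ}

namespace IsReversibleChain

variable (hK : IsReversibleChain K π)
include hK

theorem isWeight_kernel (x : X) : IsWeight (K x) := ⟨hK.kernel_nonneg x, (hK.kernel_sum x).summable⟩

theorem isWeight_prob : IsWeight π := ⟨hK.prob_nonneg, hK.prob_sum.summable⟩

theorem tsum_kernel (x : X) : ∑' y, K x y = 1 := (hK.kernel_sum x).tsum_eq

theorem abs_wsum_kernel_le {F : X → ℝ} {C : ℝ} (h : ∀ y, |F y| ≤ C) (x : X) :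
    |wsum (K x) F| ≤ C := by
  have hF : Bdd F := ⟨C, h⟩
  have h1 := (hK.isWeight_kernel x).wsum_mono hF (Bdd.const C) fun y => (abs_le.1 (h y)).2
  have h2 := (hK.isWeight_kernel x).wsum_mono (Bdd.const (-C)) hF fun y => (abs_le.1 (h y)).1
  rw [wsum_const, hK.tsum_kernel] at h1 h2
  exact abs_le.2 ⟨by linarith, by linarith⟩

theorem bdd_wsum_kernel {F : X × X → ℝ} (hF : Bdd F) :
    Bdd (fun x => wsum (K x) fun y => F (x, y)) := by
  obtain ⟨C, hC⟩ := hF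
  exact ⟨C, fun x => hK.abs_wsum_kernel_le (fun y => hC _) x⟩

theorem bdd_gen {f : X → ℝ} (hf : Bdd f) : Bdd (gen K f) :=
  hK.bdd_wsum_kernel (F := fun z => f z.2 - f z.1) ((hf.comp _).sub (hf.comp _))

theorem bdd_Gam {f g : X → ℝ} (hf : Bdd f) (hg : Bdd g) : Bdd (Gam K f g) :=
  (Bdd.const (1 / 2)).mul <| hK.bdd_wsum_kernel
    (F := fun z => (f z.2 - f z.1) * (g z.2 - g z.1))
    (((hf.comp _).sub (hf.comp _)).mul ((hg.comp _).sub (hg.comp _)))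

omit hK in
theorem gen_eq (f : X → ℝ) (x : X) : gen K f x = wsum (K x) fun y => f y - f x := rfl

omit hK in
theorem Gam_eq (f g : X → ℝ) (x : X) :
    Gam K f g x = 1 / 2 * wsum (K x) fun y => (f y - f x) * (g y - g x) := rfl

theorem Gam_self_nonneg (f : X → ℝ) (x : X) : 0 ≤ Gam K f f x := by
  rw [Gam_eq]
  have := (hK.isWeight_kernel x).wsum_nonneg (F := fun y => (f y - f x) * (f y - f x))
    fun y => mul_self_nonneg _
  linarith

/-- Cauchy-Schwarz for the probability `K x`. It turns decay of `Γ` into smallness of the Euler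
increments. -/
theorem gen_sq_le {f : X → ℝ} (hf : Bdd f) (x : X) : gen K f x ^ 2 ≤ 2 * Gam K f f x := by
  have := (hK.isWeight_kernel x).wsum_sq_le (hf.sub (Bdd.const (f x)))
  rw [hK.tsum_kernel, one_mul] at this
  rw [gen_eq, Gam_eq]
  simp only [← pow_two]
  linarith

theorem gen_eq_sub {f : X → ℝ} (hf : Bdd f) (x : X) : gen K f x = wsum (K x) f - f x := by
  rw [gen_eq, (hK.isWeight_kernel x).wsum_sub hf (Bdd.const _), wsum_const, hK.tsum_kernel, mul_one]

theorem Gam_add_right {f g k : X → ℝ} (hf : Bdd f) (hg : Bdd g) (hk : Bdd k) (x : X) :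
    Gam K f (fun z => g z + k z) x = Gam K f g x + Gam K f k x := by
  rw [Gam_eq, Gam_eq, Gam_eq, ← mul_add, ← (hK.isWeight_kernel x).wsum_add]
  · congr 2; funext y; ring
  · exact (hf.sub (Bdd.const _)).mul (hg.sub (Bdd.const _))
  · exact (hf.sub (Bdd.const _)).mul (hk.sub (Bdd.const _))

omit hK in
theorem Gam_comm (f g : X → ℝ) (x : X) : Gam K f g x = Gam K g f x := by
  rw [Gam_eq, Gam_eq]; congr 2; funext y; ring

omit hK in
theorem Gam_const_mul_right (f g : X → ℝ) (c : ℝ) (x : X) :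
    Gam K f (fun z => c * g z) x = c * Gam K f g x := by
  rw [Gam_eq, Gam_eq, mul_left_comm, ← wsum_const_mul _ _ c]; congr 2; funext y; ring

/-- The carré du champ identity for squares. -/
theorem gen_sq {u : X → ℝ} (hu : Bdd u) (x : X) :
    gen K (fun z => u z ^ 2) x = 2 * u x * gen K u x + 2 * Gam K u u x := by
  have hd : Bdd fun y => u y - u x := hu.sub (Bdd.const _)
  rw [gen_eq, gen_eq, Gam_eq, ← mul_assoc, ← wsum_const_mul, ← wsum_const_mul,
    ← (hK.isWeight_kernel x).wsum_add ((Bdd.const _).mul hd) ((Bdd.const _).mul (hd.mul hd))]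
  congr 1; funext y; ring

/-- Detailed balance propagates positivity along a path starting at a charged point. -/
theorem prob_pos (x : X) : 0 < π x := by
  have hex : ∃ y, 0 < π y := by
    by_contra! h
    have hall : ∀ y, π y = 0 := fun y => le_antisymm (h y) (hK.prob_nonneg y)
    have := hK.prob_sum.tsum_eq
    simp [hall] at this
  obtain ⟨y, hy⟩ := hex
  obtain ⟨n, c, h0, hn, hc⟩ := hK.irreducible y x
  have : ∀ i ≤ n, 0 < π (c i) := by
    intro i
    induction i with
    | zero => intro _; rwa [h0]
    | succ i ih =>
      intro hi
      have h1 : 0 < K (c (i + 1)) (c i) * π (c (i + 1)) :=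
        hK.detailed_balance (c i) (c (i + 1)) ▸ mul_pos (hc i (by omega)) (ih (by omega))
      exact pos_of_mul_pos_right h1 (hK.kernel_nonneg _ _)
  exact hn ▸ this n le_rfl

theorem kernel_symm_pos {x y : X} (h : 0 < K x y) : 0 < K y x := by
  have h1 : 0 < K y x * π y := hK.detailed_balance x y ▸ mul_pos h (hK.prob_pos x)
  exact pos_of_mul_pos_left h1 (hK.prob_pos y).le

end IsReversibleChain

/-- The symmetric edge weights `π(x) K(x,y)`. -/
def edgeWeight (K : X → X → ℝ) (π : X → ℝ) (z : X × X) : ℝ := K z.1 z.2 * π z.1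

/-- The Dirichlet form `∫ Γ(u,v) dπ`. -/
noncomputable def energy (K : X → X → ℝ) (π : X → ℝ) (u v : X → ℝ) : ℝ := wsum π (Gam K u v)

/-! ### The Dirichlet form as a sum over edges -/

namespace IsReversibleChain

variable (hK : IsReversibleChain K π)
include hK

theorem edgeWeight_nonneg (z : X × X) : 0 ≤ edgeWeight K π z :=
  mul_nonneg (hK.kernel_nonneg _ _) (hK.prob_nonneg _)

theorem edgeWeight_swap (z : X × X) : edgeWeight K π z.swap = edgeWeight K π z :=
  (hK.detailed_balance z.1 z.2).symm

theorem hasSum_edgeWeight_fst (x : X) : HasSum (fun y => edgeWeight K π (x, y)) (π x) := by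
  simpa [edgeWeight] using (hK.kernel_sum x).mul_right (π x)

/-- Functions that are integrable for `π` are integrable for the edge weights. -/
theorem summable_fst {f : X → ℝ} (hf : ∀ x, 0 ≤ f x) (hs : Summable fun x => f x * π x) :
    Summable fun z : X × X => f z.1 * edgeWeight K π z := by
  rw [summable_prod_of_nonneg fun z => mul_nonneg (hf _) (hK.edgeWeight_nonneg z)]
  refine ⟨fun x => ((hK.hasSum_edgeWeight_fst x).mul_left (f x)).summable, ?_⟩
  simpa only [((hK.hasSum_edgeWeight_fst _).mul_left (f _)).tsum_eq] using hs

theorem summable_snd {f : X → ℝ} (hf : ∀ x, 0 ≤ f x) (hs : Summable fun x => f x * π x) :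
    Summable fun z : X × X => f z.2 * edgeWeight K π z := by
  have h := (Equiv.prodComm X X).summable_iff.2 (hK.summable_fst hf hs)
  refine h.congr fun z => ?_
  simp only [Function.comp, Equiv.prodComm_apply, Prod.fst_swap]
  rw [hK.edgeWeight_swap]

theorem isWeight_edgeWeight : IsWeight (edgeWeight K π) := by
  refine ⟨hK.edgeWeight_nonneg, ?_⟩
  simpa using hK.summable_fst (f := fun _ => 1) (fun _ => zero_le_one)
    (by simpa using hK.prob_sum.summable)

theorem tsum_prob : ∑' x, π x = 1 := hK.prob_sum.tsum_eq

theorem wsum_edgeWeight {F : X × X → ℝ} (hF : Bdd F) :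
    wsum (edgeWeight K π) F = wsum π fun x => wsum (K x) fun y => F (x, y) := by
  unfold wsum
  rw [(hK.isWeight_edgeWeight.summable_mul hF).tsum_prod]
  refine tsum_congr fun x => ?_
  rw [← tsum_mul_right]
  refine tsum_congr fun y => ?_
  rw [edgeWeight, mul_assoc]

theorem wsum_edgeWeight_swap (F : X × X → ℝ) :
    wsum (edgeWeight K π) (fun z => F z.swap) = wsum (edgeWeight K π) F := by
  unfold wsum
  rw [← (Equiv.prodComm X X).tsum_eq]
  refine tsum_congr fun z => ?_
  simp only [Equiv.prodComm_apply, Prod.swap_swap, hK.edgeWeight_swap]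

theorem wsum_edgeWeight_fst {f : X → ℝ} (hf : Bdd f) :
    wsum (edgeWeight K π) (fun z => f z.1) = wsum π f := by
  rw [hK.wsum_edgeWeight (hf.comp _)]
  congr 1; funext x
  exact (wsum_const (K x) (f x)).trans (by rw [hK.tsum_kernel, mul_one])

theorem wsum_edgeWeight_snd {f : X → ℝ} (hf : Bdd f) :
    wsum (edgeWeight K π) (fun z => f z.2) = wsum π f := by
  rw [← hK.wsum_edgeWeight_fst hf, ← hK.wsum_edgeWeight_swap]
  rfl

/-- The edge weights are symmetric, so the differences cancel. This conserves mass along the Euler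
scheme and removes `LΓ(u)` from the integrated curvature condition. -/
theorem wsum_gen {f : X → ℝ} (hf : Bdd f) : wsum π (gen K f) = 0 := by
  have h := hK.wsum_edgeWeight (F := fun z => f z.2 - f z.1) ((hf.comp _).sub (hf.comp _))
  rw [hK.isWeight_edgeWeight.wsum_sub (hf.comp _) (hf.comp _), hK.wsum_edgeWeight_fst hf,
    hK.wsum_edgeWeight_snd hf, sub_self] at h
  exact h.symm

omit hK in
theorem bdd_edge {f g : X → ℝ} (hf : Bdd f) (hg : Bdd g) :
    Bdd fun z : X × X => (f z.2 - f z.1) * (g z.2 - g z.1) :=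
  ((hf.comp _).sub (hf.comp _)).mul ((hg.comp _).sub (hg.comp _))

theorem energy_eq {f g : X → ℝ} (hf : Bdd f) (hg : Bdd g) :
    energy K π f g
      = 1 / 2 * wsum (edgeWeight K π) fun z => (f z.2 - f z.1) * (g z.2 - g z.1) := by
  rw [hK.wsum_edgeWeight (bdd_edge hf hg), ← wsum_const_mul]
  rfl

theorem energy_nonneg (f : X → ℝ) : 0 ≤ energy K π f f :=
  hK.isWeight_prob.wsum_nonneg fun x => hK.Gam_self_nonneg f x

theorem energy_add_right {f g k : X → ℝ} (hf : Bdd f) (hg : Bdd g) (hk : Bdd k) :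
    energy K π f (fun z => g z + k z) = energy K π f g + energy K π f k := by
  unfold energy
  rw [← hK.isWeight_prob.wsum_add (hK.bdd_Gam hf hg) (hK.bdd_Gam hf hk)]
  congr 1; funext x
  exact hK.Gam_add_right hf hg hk x

omit hK in
theorem energy_comm (f g : X → ℝ) : energy K π f g = energy K π g f := by
  unfold energy
  congr 1; funext x
  exact Gam_comm f g x

theorem energy_add_self {f g : X → ℝ} (hf : Bdd f) (hg : Bdd g) :
    energy K π (fun z => f z + g z) (fun z => f z + g z)
      = energy K π f f + 2 * energy K π f g + energy K π g g := by
  have hfg := hf.add hg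
  rw [hK.energy_add_right hfg hf hg, energy_comm _ f, energy_comm _ g,
    hK.energy_add_right hf hf hg, hK.energy_add_right hg hf hg, energy_comm g f]
  ring

omit hK in
theorem energy_const_mul_right (f g : X → ℝ) (c : ℝ) :
    energy K π f (fun z => c * g z) = c * energy K π f g := by
  unfold energy
  rw [← wsum_const_mul]
  congr 1; funext x
  exact Gam_const_mul_right f g c x

omit hK in
theorem energy_const_mul_self (f : X → ℝ) (c : ℝ) :
    energy K π (fun z => c * f z) (fun z => c * f z) = c ^ 2 * energy K π f f := by
  rw [energy_const_mul_right, energy_comm, energy_const_mul_right]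
  ring

theorem energy_mono {f g : X → ℝ} (hf : Bdd f) (hg : Bdd g) {c : ℝ}
    (h : ∀ x y, |f y - f x| ≤ c * |g y - g x|) :
    energy K π f f ≤ c ^ 2 * energy K π g g := by
  rw [hK.energy_eq hf hf, hK.energy_eq hg hg, mul_left_comm, ← wsum_const_mul _ _ (c ^ 2)]
  refine mul_le_mul_of_nonneg_left ?_ (by norm_num : (0 : ℝ) ≤ 1 / 2)
  refine hK.isWeight_edgeWeight.wsum_mono (bdd_edge hf hf) ((Bdd.const _).mul (bdd_edge hg hg)) ?_
  intro z
  have h1 := pow_le_pow_left₀ (abs_nonneg _) (h z.1 z.2) 2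
  rw [mul_pow, sq_abs, sq_abs] at h1
  linarith

/-- From `(a - b)² ≤ 2a² + 2b²`: the Dirichlet form is bounded on `L²(π)`, which lets second order
errors of the explicit scheme be absorbed. -/
theorem energy_le_two_mul {f : X → ℝ} (hf : Bdd f) :
    energy K π f f ≤ 2 * wsum π fun x => f x ^ 2 := by
  have h := hK.isWeight_edgeWeight.wsum_mono (bdd_edge hf hf)
    ((((Bdd.const 2).mul (hf.sq.comp Prod.snd))).add (((Bdd.const 2).mul (hf.sq.comp Prod.fst))))
    fun z => by nlinarith [sq_nonneg (f z.2 + f z.1)]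
  rw [hK.isWeight_edgeWeight.wsum_add ((Bdd.const 2).mul (hf.sq.comp Prod.snd))
    ((Bdd.const 2).mul (hf.sq.comp Prod.fst)), wsum_const_mul, wsum_const_mul,
    hK.wsum_edgeWeight_fst hf.sq, hK.wsum_edgeWeight_snd hf.sq] at h
  rw [hK.energy_eq hf hf]
  linarith

/-- The weighted arithmetic-geometric mean inequality for the Dirichlet form. -/
theorem two_mul_energy_le {f g : X → ℝ} (hf : Bdd f) (hg : Bdd g) {t : ℝ} (ht : 0 < t) :
    2 * energy K π f g ≤ t * energy K π f f + t⁻¹ * energy K π g g := by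
  have h0 := hK.energy_nonneg (fun z => t * f z + (-1) * g z)
  rw [hK.energy_add_self ((Bdd.const _).mul hf) ((Bdd.const _).mul hg), energy_const_mul_self,
    energy_const_mul_self, energy_const_mul_right, energy_comm _ g, energy_const_mul_right,
    energy_comm g f] at h0
  have h1 : 2 * energy K π f g * t ≤ (t * energy K π f f + t⁻¹ * energy K π g g) * t := by
    field_simp
    linarith
  exact le_of_mul_le_mul_right h1 ht

theorem wsum_gen_sq_le {f : X → ℝ} (hf : Bdd f) :
    wsum π (fun x => gen K f x ^ 2) ≤ 2 * energy K π f f := by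
  unfold energy
  rw [← wsum_const_mul]
  exact hK.isWeight_prob.wsum_mono (hK.bdd_gen hf).sq ((Bdd.const 2).mul (hK.bdd_Gam hf hf))
    fun x => hK.gen_sq_le hf x

/-! ### Decay of the energy of the square root -/

/-- The integrated form of the exponential curvature condition. -/
theorem energy_gen_sq_div_le {κ : ℝ} (hCDE : CDEprime K κ) {u : X → ℝ} {α : ℝ} (hα : 0 < α)
    (hu : ∀ x, α ≤ u x) (hub : Bdd u) :
    energy K π u (fun z => gen K (fun y => u y ^ 2) z / (2 * u z)) ≤ -κ * energy K π u u := by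
  have hG := hK.bdd_Gam hub hub
  have hL := hK.bdd_gen hub
  obtain ⟨β, hβ⟩ := hub
  have hpt : ∀ x, Gam K u (fun z => gen K (fun y => u y ^ 2) z / (2 * u z)) x
      ≤ 1 / 2 * gen K (Gam K u u) x + (-κ) * Gam K u u x := by
    intro x
    -- Writing the quotient as `Lu + Γ(u)/u` makes exactly the two subtracted terms of the modified
    -- `Γ₂` appear.
    have h1 : (fun z => gen K (fun y => u y ^ 2) z / (2 * u z))
        = fun z => gen K u z + Gam K u u z / u z := by
      funext z
      have : u z ≠ 0 := (hα.trans_le (hu z)).ne'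
      rw [hK.gen_sq ⟨β, hβ⟩]
      field_simp
    have h2 := hCDE u ⟨α, hα, hu⟩ ⟨β, fun x => (le_abs_self _).trans (hβ x)⟩ x
    rw [h1, hK.Gam_add_right ⟨β, hβ⟩ hL (hG.div hα hu)]
    unfold modGam2 Gam2 at h2
    have h3 : Gam K u (gen K u) x = Gam K u (fun z => gen K u z) x := rfl
    linarith
  have hub : Bdd u := ⟨β, hβ⟩
  have hw : Bdd fun z => gen K (fun y => u y ^ 2) z / (2 * u z) :=
    (hK.bdd_gen hub.sq).div (a := 2 * α) (by positivity) fun x => by linarith [hu x]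
  have := hK.isWeight_prob.wsum_mono (hK.bdd_Gam hub hw)
    (((Bdd.const _).mul (hK.bdd_gen hG)).add ((Bdd.const _).mul hG)) hpt
  rw [hK.isWeight_prob.wsum_add ((Bdd.const _).mul (hK.bdd_gen hG)) ((Bdd.const _).mul hG),
    wsum_const_mul, wsum_const_mul, hK.wsum_gen hG] at this
  unfold energy
  linarith

/-- One step of the Euler scheme keeps the bounds. -/
theorem euler_mem_Icc {f : X → ℝ} {a b : ℝ} (hf : ∀ x, f x ∈ Set.Icc a b) {h : ℝ} (h0 : 0 ≤ h)
    (h1 : h ≤ 1) (x : X) : f x + h * gen K f x ∈ Set.Icc a b := by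
  have hb := Bdd.of_mem_Icc hf
  have e1 := (hK.isWeight_kernel x).wsum_mono hb (Bdd.const b) fun y => (hf y).2
  have e2 := (hK.isWeight_kernel x).wsum_mono (Bdd.const a) hb fun y => (hf y).1
  rw [wsum_const, hK.tsum_kernel, mul_one] at e1 e2
  -- The new value is the convex combination of `f x` and the `K x`-average of `f`, with weights `1
  -- - h` and `h`.
  rw [hK.gen_eq_sub hb]
  have := hf x
  constructor <;> nlinarith [this.1, this.2]

theorem wsum_euler {f : X → ℝ} (hf : Bdd f) (h : ℝ) :
    wsum π (fun x => f x + h * gen K f x) = wsum π f := by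
  rw [hK.isWeight_prob.wsum_add hf ((Bdd.const _).mul (hK.bdd_gen hf)), wsum_const_mul,
    hK.wsum_gen hf, mul_zero, add_zero]

/-- The energy of the square root contracts along the Euler scheme, up to a second order term. -/
theorem energy_sqrt_euler_le {κ : ℝ} (hCDE : CDEprime K κ) {α β : ℝ} (hα : 0 < α) :
    ∃ C, 0 < C ∧ ∀ h, 0 < h → h ≤ 1 → ∀ u : X → ℝ, (∀ x, u x ∈ Set.Icc α β) →
      energy K π (fun x => √(u x ^ 2 + h * gen K (fun y => u y ^ 2) x))
          (fun x => √(u x ^ 2 + h * gen K (fun y => u y ^ 2) x))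
        ≤ (1 - 2 * κ * h + C * h ^ 2) * energy K π u u := by
  -- With `w = Lf/(2u)`, the increment splits as `v = h w + r`, where `|v| ≤ h A |Lf|` and `|r| ≤ h²
  -- B |Lf|`. In the constant below, `1` and the `B` term come from the cross energy of `u` and `r`,
  -- the `A` term from the energy of `v`.
  set A : ℝ := 1 / (2 * α) with hA
  set B : ℝ := β ^ 2 * A ^ 2 / (2 * α) with hB
  refine ⟨1 + 16 * β ^ 2 * B ^ 2 + 16 * β ^ 2 * A ^ 2, by positivity, ?_⟩
  intro h h0 h1 u hu
  have hub : Bdd u := Bdd.of_mem_Icc hu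
  have hα' : ∀ x, 0 < u x := fun x => hα.trans_le (hu x).1
  set f : X → ℝ := fun y => u y ^ 2 with hf
  have hfb : Bdd f := hub.sq
  have hfI : ∀ x, f x ∈ Set.Icc (α ^ 2) (β ^ 2) := fun x =>
    ⟨pow_le_pow_left₀ hα.le (hu x).1 2, pow_le_pow_left₀ (hα' x).le (hu x).2 2⟩
  have hL := hK.bdd_gen hfb
  set u' : X → ℝ := fun x => √(f x + h * gen K f x) with hu'
  have hE := hK.euler_mem_Icc hfI h0.le h1
  have hsq : ∀ x, u' x ^ 2 = f x + h * gen K f x := fun x =>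
    Real.sq_sqrt ((by positivity : (0 : ℝ) ≤ α ^ 2).trans (hE x).1)
  have hu'α : ∀ x, α ≤ u' x := fun x => Real.le_sqrt_of_sq_le (hE x).1
  have hu'b : Bdd u' := by
    refine Bdd.of_mem_Icc (a := α) (b := √(β ^ 2)) fun x => ⟨hu'α x, Real.sqrt_le_sqrt (hE x).2⟩
  set w : X → ℝ := fun x => gen K f x / (2 * u x) with hw
  have hwb : Bdd w := hL.div (a := 2 * α) (by positivity) fun x => by linarith [(hu x).1]
  set v : X → ℝ := fun x => u' x - u x with hv
  have hvb : Bdd v := hu'b.sub hub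
  set r : X → ℝ := fun x => v x - h * w x with hr
  have hrb : Bdd r := hvb.sub ((Bdd.const _).mul hwb)
  have hA0 : 0 < A := by positivity
  have hB0 : 0 ≤ B := by positivity
  have hgen : ∀ x, |gen K f x| ≤ β ^ 2 := by
    intro x
    refine hK.abs_wsum_kernel_le (F := fun y => f y - f x) (fun y => ?_) x
    have h1 := hfI x
    have h2 := hfI y
    rw [abs_le]
    constructor <;> nlinarith [h1.1, h1.2, h2.1, h2.2, sq_nonneg α]
  have hvle : ∀ x, |v x| ≤ h * A * |gen K f x| := by
    intro x
    have e : v x * (u' x + u x) = h * gen K f x := by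
      have := hsq x
      simp only [hv, hf] at this ⊢
      linarith
    have e1 : |v x| * (u' x + u x) = h * |gen K f x| := by
      rw [← abs_of_pos (add_pos (hα.trans_le (hu'α x)) (hα' x)), ← abs_mul, e, abs_mul,
        abs_of_pos h0]
    have e2 : |v x| * (2 * α) ≤ h * |gen K f x| := by
      rw [← e1]
      exact mul_le_mul_of_nonneg_left (by linarith [hu'α x, (hu x).1]) (abs_nonneg _)
    rw [hA]
    have e3 : h * (1 / (2 * α)) * |gen K f x| = h * |gen K f x| / (2 * α) := by ring
    rw [e3, le_div_iff₀ (by positivity)]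
    exact e2
  have hrle : ∀ x, |r x| ≤ h ^ 2 * B * |gen K f x| := by
    intro x
    have hux := hα' x
    -- Expanding `(u + v)² = u² + h Lf` gives `2uv - h Lf = -v²`.
    have e : r x * (2 * u x) = -(v x ^ 2) := by
      have := hsq x
      simp only [hr, hv, hw, hf] at this ⊢
      field_simp
      nlinarith
    have e1 : |r x| * (2 * u x) = |v x| ^ 2 := by
      rw [sq_abs, ← abs_of_pos (by positivity : 0 < 2 * u x), ← abs_mul, e, abs_neg,
        abs_of_nonneg (sq_nonneg _)]
    -- Only one factor `|Lf|` is replaced by its bound. The other is kept so that the error is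
    -- proportional to the energy of `u`, as geometric decay requires.
    have e2 : |v x| ^ 2 ≤ h ^ 2 * A ^ 2 * β ^ 2 * |gen K f x| := by
      calc |v x| ^ 2 ≤ (h * A * |gen K f x|) ^ 2 := pow_le_pow_left₀ (abs_nonneg _) (hvle x) 2
        _ = h ^ 2 * A ^ 2 * |gen K f x| * |gen K f x| := by ring
        _ ≤ h ^ 2 * A ^ 2 * β ^ 2 * |gen K f x| := by gcongr; exact hgen x
    have e3 : |r x| * (2 * α) ≤ |r x| * (2 * u x) :=
      mul_le_mul_of_nonneg_left (by linarith [(hu x).1]) (abs_nonneg _)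
    have e4 : h ^ 2 * B * |gen K f x| = h ^ 2 * A ^ 2 * β ^ 2 * |gen K f x| / (2 * α) := by
      rw [hB]; ring
    rw [e4, le_div_iff₀ (by positivity)]
    linarith
  have hff : energy K π f f ≤ (2 * β) ^ 2 * energy K π u u := by
    refine hK.energy_mono hfb hub fun x y => ?_
    have : f y - f x = (u y + u x) * (u y - u x) := by simp only [hf]; ring
    rw [this, abs_mul, abs_of_pos (add_pos (hα' y) (hα' x))]
    exact mul_le_mul_of_nonneg_right (by linarith [(hu x).2, (hu y).2]) (abs_nonneg _)
  have hNL : wsum π (fun x => gen K f x ^ 2) ≤ 8 * β ^ 2 * energy K π u u := by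
    have := hK.wsum_gen_sq_le hfb
    nlinarith
  have henergy : ∀ (g : X → ℝ) (c : ℝ), Bdd g → (∀ x, |g x| ≤ c * |gen K f x|) →
      energy K π g g ≤ 16 * β ^ 2 * c ^ 2 * energy K π u u := by
    intro g c hg hgc
    have h2 : wsum π (fun x => g x ^ 2) ≤ c ^ 2 * wsum π fun x => gen K f x ^ 2 := by
      rw [← wsum_const_mul]
      refine hK.isWeight_prob.wsum_mono hg.sq ((Bdd.const _).mul hL.sq) fun x => ?_
      have := pow_le_pow_left₀ (abs_nonneg _) (hgc x) 2
      rwa [mul_pow, sq_abs, sq_abs] at this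
    have h3 := hK.energy_le_two_mul hg
    have h4 := mul_le_mul_of_nonneg_left hNL (sq_nonneg c)
    linarith
  have hEv := henergy v _ hvb hvle
  have hEr := henergy r _ hrb hrle
  have hEw := hK.energy_gen_sq_div_le hCDE hα (fun x => (hu x).1) hub
  -- The energy of `r` is of order `h⁴`, so the weight `t = h²` makes both terms of order `h²`.
  have h2 := hK.two_mul_energy_le hub hrb (t := h ^ 2) (by positivity)
  have hdec : u' = fun x => u x + v x := by funext x; simp [hv]
  have hvd : energy K π u v = h * energy K π u w + energy K π u r := by
    rw [← energy_const_mul_right, ← hK.energy_add_right hub ((Bdd.const _).mul hwb) hrb]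
    congr 1; funext x; simp [hr]
  have h3 : (h ^ 2)⁻¹ * energy K π r r ≤ h ^ 2 * (16 * β ^ 2 * B ^ 2) * energy K π u u := by
    rw [inv_mul_le_iff₀ (by positivity)]
    linarith
  rw [hdec, hK.energy_add_self hub hvb, hvd]
  have h4 := mul_le_mul_of_nonneg_left hEw h0.le
  change h * energy K π u w ≤ _ at h4
  linarith

end IsReversibleChain

/-! ### The graph distance -/

namespace IsReversibleChain

variable (hK : IsReversibleChain K π)

section
include hK

theorem hasPath_graphDist (x y : X) : HasPath K (graphDist K x y) x y :=
  Nat.sInf_mem (hK.irreducible x y)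

theorem graphDist_le_add_one (x : X) {y z : X} (h : 0 < K y z) :
    graphDist K x z ≤ graphDist K x y + 1 := by
  obtain ⟨c, h0, hn, hc⟩ := hK.hasPath_graphDist x y
  set n := graphDist K x y
  refine Nat.sInf_le ⟨fun i => if i ≤ n then c i else z, by simp [h0], by simp, fun i hi => ?_⟩
  rcases Nat.lt_or_ge i n with h' | h'
  · simpa [h'.le, Nat.succ_le_of_lt h'] using hc i h'
  · obtain rfl : i = n := by omega
    simpa [hn] using h

theorem graphDist_triangle (x y z : X) :
    graphDist K x z ≤ graphDist K x y + graphDist K y z := by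
  obtain ⟨c, h0, hn, hc⟩ := hK.hasPath_graphDist y z
  have : ∀ i ≤ graphDist K y z, graphDist K x (c i) ≤ graphDist K x y + i := by
    intro i
    induction i with
    | zero => intro _; rw [h0]; omega
    | succ i ih =>
      intro hi
      have := hK.graphDist_le_add_one x (hc i (by omega))
      have := ih (by omega)
      omega
  have := this _ le_rfl
  rwa [hn] at this

end

theorem graphDist_self (x : X) : graphDist K x x = 0 :=
  Nat.le_zero.1 (Nat.sInf_le ⟨fun _ => x, rfl, rfl, fun _ hi => absurd hi (Nat.not_lt_zero _)⟩)

theorem graphDist_le_one {x y : X} (h : 0 < K x y) : graphDist K x y ≤ 1 := by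
  refine Nat.sInf_le ⟨fun i => if i = 0 then x else y, rfl, rfl, fun i hi => ?_⟩
  obtain rfl : i = 0 := by omega
  simpa using h

include hK

/-- If the increments along edges tend to zero, so do all increments. -/
theorem tendsto_sub_of_edge {g : ℕ → X → ℝ}
    (h : ∀ x y, 0 < K x y → Tendsto (fun n => g n y - g n x) atTop (𝓝 0)) (x y : X) :
    Tendsto (fun n => g n y - g n x) atTop (𝓝 0) := by
  obtain ⟨m, c, h0, hm, hc⟩ := hK.irreducible x y
  have : ∀ i ≤ m, Tendsto (fun n => g n (c i) - g n x) atTop (𝓝 0) := by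
    intro i
    induction i with
    | zero => intro _; simp [h0]
    | succ i ih =>
      intro hi
      have := (h _ _ (hc i (by omega))).add (ih (by omega))
      simpa using this
  exact hm ▸ this m le_rfl

/-! ### The Bakry-Émery criterion and the diameter bound -/

omit hK in
theorem gen_one_add_mul (ε : ℝ) (g : X → ℝ) (x : X) :
    gen K (fun z => 1 + ε * g z) x = ε * gen K g x := by
  rw [gen_eq, gen_eq, ← wsum_const_mul]; congr 1; funext y; ring

omit hK in
theorem Gam_one_add_mul (ε : ℝ) (g k : X → ℝ) (x : X) :
    Gam K (fun z => 1 + ε * g z) k x = ε * Gam K g k x := by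
  rw [Gam_eq, Gam_eq, mul_left_comm, ← wsum_const_mul _ _ ε]; congr 2; funext y; ring

/-- The exponential curvature condition implies the Bakry-Émery condition. -/
theorem le_Gam2 {κ : ℝ} (hCDE : CDEprime K κ) {g : X → ℝ} (hg : Bdd g) (x : X) :
    κ * Gam K g g x ≤ Gam2 K g x := by
  obtain ⟨M, hM0, hM⟩ := hg.exists_pos
  obtain ⟨G, hG0, hG⟩ := (hK.bdd_Gam hg hg).exists_pos
  -- For the test function `1 + εg`, the term `Γ(f, Γ(f)/f)` is of order `ε³` while all others are
  -- exactly quadratic in `ε`; dividing by `ε²` leaves an error of order `ε`.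
  have key : ∀ ε : ℝ, 0 < ε → ε * M ≤ 1 / 2 →
      κ * Gam K g g x ≤ Gam2 K g x + ε * (1 / 2 * ((2 * M) * (4 * G))) := by
    intro ε hε hεM
    have hlow : ∀ z, 1 / 2 ≤ 1 + ε * g z := fun z => by
      have := mul_le_mul_of_nonneg_left (abs_le.1 (hM z)).1 hε.le
      linarith
    have h := hCDE (fun z => 1 + ε * g z) ⟨1 / 2, by norm_num, hlow⟩
      ⟨1 + ε * M, fun z => by
        have := mul_le_mul_of_nonneg_left (abs_le.1 (hM z)).2 hε.le
        linarith⟩ x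
    have hGG : Gam K (fun z => 1 + ε * g z) (fun z => 1 + ε * g z) = fun z => ε ^ 2 * Gam K g g z := by
      funext z
      rw [Gam_one_add_mul, Gam_comm, Gam_one_add_mul]; ring
    set k : X → ℝ := fun z => Gam K g g z / (1 + ε * g z) with hk
    have hkb : ∀ z, |k z| ≤ 2 * G := by
      intro z
      have h1 := hlow z
      rw [hk]
      simp only
      rw [abs_div, abs_of_pos (by linarith : 0 < 1 + ε * g z), div_le_iff₀ (by linarith)]
      have := hG z
      nlinarith
    have hlast : Gam K (fun z => 1 + ε * g z) (fun z => ε ^ 2 * Gam K g g z / (1 + ε * g z)) x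
        = ε ^ 2 * (ε * Gam K g k x) := by
      have : (fun z => ε ^ 2 * Gam K g g z / (1 + ε * g z)) = fun z => ε ^ 2 * k z := by
        funext z; rw [hk]; ring
      rw [this, Gam_const_mul_right, Gam_one_add_mul]
    have hbd : |Gam K g k x| ≤ 1 / 2 * ((2 * M) * (4 * G)) := by
      rw [Gam_eq, abs_mul, abs_of_pos (by norm_num : (0 : ℝ) < 1 / 2)]
      refine mul_le_mul_of_nonneg_left (hK.abs_wsum_kernel_le (fun y => ?_) x) (by norm_num)
      rw [abs_mul]
      refine mul_le_mul ?_ ?_ (abs_nonneg _) (by positivity)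
      · exact (abs_sub _ _).trans (by linarith [hM y, hM x])
      · exact (abs_sub _ _).trans (by linarith [hkb y, hkb x])
    have hgen : gen K (fun z => ε ^ 2 * Gam K g g z) x = ε ^ 2 * gen K (Gam K g g) x := by
      rw [gen_eq, gen_eq, ← wsum_const_mul]; congr 1; funext y; ring
    have hgg : gen K (fun z => 1 + ε * g z) = fun z => ε * gen K g z :=
      funext fun z => gen_one_add_mul ε g z
    have h2 : Gam K (fun z => 1 + ε * g z) (gen K fun z => 1 + ε * g z) x
        = ε ^ 2 * Gam K g (gen K g) x := by
      rw [hgg, Gam_one_add_mul, Gam_const_mul_right]; ring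
    unfold modGam2 Gam2 at h
    rw [h2, hGG, hgen, hlast] at h
    unfold Gam2
    have h3 : ε ^ 2 * (κ * Gam K g g x)
        ≤ ε ^ 2 * (1 / 2 * gen K (Gam K g g) x - Gam K g (gen K g) x - ε * Gam K g k x) := by
      linarith
    have h4 := le_of_mul_le_mul_left h3 (by positivity)
    have h5 := mul_le_mul_of_nonneg_left (abs_le.1 hbd).1 hε.le
    linarith
  have hlim : Tendsto (fun ε : ℝ => Gam2 K g x + ε * (1 / 2 * ((2 * M) * (4 * G)))) (𝓝[>] 0)
      (𝓝 (Gam2 K g x + 0 * (1 / 2 * ((2 * M) * (4 * G))))) :=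
    ((continuous_const.add (continuous_id.mul continuous_const)).tendsto 0).mono_left
      nhdsWithin_le_nhds
  rw [zero_mul, add_zero] at hlim
  refine ge_of_tendsto hlim ?_
  have : Set.Ioo (0 : ℝ) (1 / (2 * M)) ∈ 𝓝[>] (0 : ℝ) := Ioo_mem_nhdsGT (by positivity)
  filter_upwards [this] with ε hε
  refine key ε hε.1 ?_
  have := mul_le_mul_of_nonneg_right hε.2.le hM0.le
  have e : 1 / (2 * M) * M = 1 / 2 := by field_simp
  linarith

/-- One step of the Euler scheme contracts the carré du champ. -/
theorem Gam_euler_le {κ : ℝ} (hCDE : CDEprime K κ) {h : ℝ} (h0 : 0 < h)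
    (h1 : h * (1 + 2 * κ) ≤ 1) {g : X → ℝ} (hg : Bdd g) {c : ℝ} (hc : ∀ x, Gam K g g x ≤ c)
    (x : X) :
    Gam K (fun z => g z + h * gen K g z) (fun z => g z + h * gen K g z) x
      ≤ (1 - 2 * h * κ + 4 * h ^ 2) * c := by
  have hL := hK.bdd_gen hg
  have hG := hK.bdd_Gam hg hg
  have hhL : Bdd fun z => h * gen K g z := (Bdd.const _).mul hL
  have hs := hg.add hhL
  have hexp : Gam K (fun z => g z + h * gen K g z) (fun z => g z + h * gen K g z) x
      = Gam K g g x + 2 * h * Gam K g (gen K g) x + h ^ 2 * Gam K (gen K g) (gen K g) x := by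
    have e1 : Gam K g (fun z => h * gen K g z) x = h * Gam K g (gen K g) x :=
      Gam_const_mul_right g (gen K g) h x
    have e2 : Gam K (fun z => h * gen K g z) (fun z => h * gen K g z) x
        = h ^ 2 * Gam K (gen K g) (gen K g) x := by
      have e3 := Gam_const_mul_right (K := K) (gen K g) (gen K g) h x
      rw [Gam_const_mul_right (K := K) (fun z => h * gen K g z) (gen K g) h x, Gam_comm, e3]
      ring
    rw [hK.Gam_add_right hs hg hhL, Gam_comm _ g, hK.Gam_add_right hg hg hhL,
      Gam_comm (fun i => g i + h * gen K g i) fun z => h * gen K g z,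
      hK.Gam_add_right hhL hg hhL, Gam_comm (fun z => h * gen K g z) g, e1, e2]
    ring
  have hcd := hK.le_Gam2 hCDE hg x
  unfold Gam2 at hcd
  -- `LΓ(g)` is an average of `Γ(g)`, hence at most `c`, minus `Γ(g)(x)`.
  have hLG : gen K (Gam K g g) x ≤ c - Gam K g g x := by
    rw [hK.gen_eq_sub hG]
    have := (hK.isWeight_kernel x).wsum_mono hG (Bdd.const c) hc
    rw [wsum_const, hK.tsum_kernel, mul_one] at this
    linarith
  have hLL : Gam K (gen K g) (gen K g) x ≤ 4 * c := by
    have hle : ∀ z, gen K g z ^ 2 ≤ 2 * c := fun z =>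
      (hK.gen_sq_le hg z).trans (by linarith [hc z])
    have hb : Bdd fun y => gen K g y - gen K g x := hL.sub (Bdd.const _)
    have := (hK.isWeight_kernel x).wsum_mono (hb.mul hb) (Bdd.const (8 * c)) fun y => by
      nlinarith [hle x, hle y, sq_nonneg (gen K g y + gen K g x)]
    rw [wsum_const, hK.tsum_kernel, mul_one] at this
    rw [Gam_eq]
    linarith
  rw [hexp]
  have e1 := mul_le_mul_of_nonneg_left hcd h0.le
  have e2 := mul_le_mul_of_nonneg_left hLG h0.le
  have e3 := mul_le_mul_of_nonneg_left hLL (sq_nonneg h)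
  -- After the curvature bound, `Γ(g)(x)` has coefficient `1 - h - 2hκ`; the restriction on `h`
  -- makes it nonnegative, so `Γ(g)(x)` may be replaced by `c`.
  have e4 : (1 - h * (1 + 2 * κ)) * Gam K g g x ≤ (1 - h * (1 + 2 * κ)) * c :=
    mul_le_mul_of_nonneg_left (hc x) (by linarith)
  nlinarith

/-- Under positive exponential curvature, the diameter is finite. -/
theorem exists_graphDist_le {κ : ℝ} (hκ : 0 < κ) (hCDE : CDEprime K κ) :
    ∃ D : ℕ, ∀ x y, graphDist K x y ≤ D := by
  set h : ℝ := min (κ / 4) (1 / (1 + 2 * κ)) with hh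
  have h0 : 0 < h := by positivity
  have h4 : h ≤ κ / 4 := min_le_left _ _
  have h1 : h * (1 + 2 * κ) ≤ 1 := by
    have := mul_le_mul_of_nonneg_right (min_le_right (κ / 4) (1 / (1 + 2 * κ)))
      (by positivity : 0 ≤ 1 + 2 * κ)
    rwa [one_div_mul_cancel (by positivity)] at this
  -- As `h ≤ κ/4`, the contraction factor is at most `1 - hκ ≤ r²`.
  set r : ℝ := 1 - h * κ / 2 with hr
  have hr0 : 0 ≤ r := by nlinarith
  have hr1 : r < 1 := by nlinarith [mul_pos h0 hκ]
  have hrsq : 1 - 2 * h * κ + 4 * h ^ 2 ≤ r ^ 2 := by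
    have : 4 * h ^ 2 ≤ h * κ := by nlinarith
    nlinarith [sq_nonneg (h * κ)]
  set B : ℝ := h / (1 - r) with hB
  -- The truncation keeps the distance function bounded, but the estimate does not depend on `R`.
  -- The iterates move by at most `B` in total, while their differences tend to zero, so the initial
  -- oscillation is at most `2B`.
  have key : ∀ (x₀ : X) (R : ℕ) (x y : X),
      ((min (graphDist K x₀ y) R : ℕ) : ℝ) - ((min (graphDist K x₀ x) R : ℕ) : ℝ) ≤ 2 * B := by
    intro x₀ R
    set g₀ : X → ℝ := fun z => ((min (graphDist K x₀ z) R : ℕ) : ℝ) with hg₀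
    have hg₀b : Bdd g₀ := ⟨R, fun z => by
      rw [hg₀]; simp only
      rw [Nat.abs_cast]; exact_mod_cast min_le_right _ _⟩
    set S : (X → ℝ) → X → ℝ := fun g z => g z + h * gen K g z with hS
    set g : ℕ → X → ℝ := fun n => S^[n] g₀ with hg
    have hsucc : ∀ n z, g (n + 1) z = g n z + h * gen K (g n) z := by
      intro n z
      rw [hg]; simp only
      rw [Function.iterate_succ_apply']
    have hgs : ∀ n, g (n + 1) = fun z => g n z + h * gen K (g n) z := fun n => funext (hsucc n)
    have hgb : ∀ n, Bdd (g n) := by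
      intro n
      induction n with
      | zero => exact hg₀b
      | succ n ih => rw [hgs]; exact ih.add ((Bdd.const _).mul (hK.bdd_gen ih))
    have hΓ : ∀ n x, Gam K (g n) (g n) x ≤ (r ^ n) ^ 2 * (1 / 2) := by
      intro n
      induction n with
      | zero =>
        intro x
        change Gam K g₀ g₀ x ≤ _
        rw [Gam_eq, pow_zero, one_pow, one_mul]
        have : wsum (K x) (fun y => (g₀ y - g₀ x) * (g₀ y - g₀ x)) ≤ 1 := by
          rw [← hK.tsum_kernel x]
          have hb : Bdd fun y => g₀ y - g₀ x := hg₀b.sub (Bdd.const _)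
          refine ((hK.isWeight_kernel x).summable_mul (hb.mul hb)).tsum_le_tsum (fun y => ?_)
            (hK.isWeight_kernel x).summable
          rcases (hK.kernel_nonneg x y).eq_or_lt with h | h
          · simp [← h]
          · have e1 := hK.graphDist_le_add_one x₀ h
            have e2 := hK.graphDist_le_add_one x₀ (hK.kernel_symm_pos h)
            have e3 : g₀ y ≤ g₀ x + 1 := by rw [hg₀]; simp only; norm_cast; omega
            have e4 : g₀ x ≤ g₀ y + 1 := by rw [hg₀]; simp only; norm_cast; omega
            have : (g₀ y - g₀ x) * (g₀ y - g₀ x) ≤ 1 := by nlinarith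
            nlinarith
        linarith
      | succ n ih =>
        intro x
        rw [hgs]
        refine (hK.Gam_euler_le hCDE h0 h1 (hgb n) ih x).trans ?_
        have := mul_le_mul_of_nonneg_right hrsq (by positivity : 0 ≤ (r ^ n) ^ 2 * (1 / 2))
        calc _ ≤ _ := this
          _ = _ := by ring
    have hstep : ∀ n x, |g (n + 1) x - g n x| ≤ h * r ^ n := by
      intro n x
      rw [hsucc, add_sub_cancel_left, abs_mul, abs_of_pos h0]
      refine mul_le_mul_of_nonneg_left ?_ h0.le
      refine abs_le_of_sq_le_sq ?_ (by positivity)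
      linarith [hK.gen_sq_le (hgb n) x, hΓ n x]
    have hdisp : ∀ n x, |g n x - g₀ x| ≤ B := by
      intro n x
      have h2 : |g n x - g₀ x| ≤ ∑ i ∈ Finset.range n, h * r ^ i := by
        induction n with
        | zero => simp [hg]
        | succ n ih =>
          rw [Finset.sum_range_succ]
          have : g (n + 1) x - g₀ x = (g n x - g₀ x) + (g (n + 1) x - g n x) := by ring
          rw [this]
          exact (abs_add_le _ _).trans (add_le_add ih (hstep n x))
      refine h2.trans ?_
      rw [← Finset.mul_sum, hB, div_eq_mul_inv]
      refine mul_le_mul_of_nonneg_left ?_ h0.le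
      rw [← tsum_geometric_of_lt_one hr0 hr1]
      exact (summable_geometric_of_lt_one hr0 hr1).sum_le_tsum _ fun i _ => pow_nonneg hr0 i
    have hrn : Tendsto (fun n => r ^ n) atTop (𝓝 0) := tendsto_pow_atTop_nhds_zero_of_lt_one hr0 hr1
    have hedge : ∀ x y, 0 < K x y → Tendsto (fun n => g n y - g n x) atTop (𝓝 0) := by
      intro x y hxy
      have hle : ∀ n, |g n y - g n x| ≤ r ^ n * √(1 / K x y) := by
        intro n
        have hb : Bdd fun y => g n y - g n x := (hgb n).sub (Bdd.const _)
        have e1 := (hK.isWeight_kernel x).le_wsum (hb.mul hb) (fun y => mul_self_nonneg _) y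
        have e2 := hΓ n x
        rw [Gam_eq] at e2
        refine abs_le_of_sq_le_sq ?_ (by positivity)
        rw [mul_pow, Real.sq_sqrt (by positivity), mul_one_div, le_div_iff₀ hxy]
        nlinarith
      refine squeeze_zero_norm hle ?_
      simpa using hrn.mul_const (√(1 / K x y))
    intro x y
    have hlim := (hK.tendsto_sub_of_edge hedge x y).add_const (2 * B)
    rw [zero_add] at hlim
    refine ge_of_tendsto' hlim fun n => ?_
    have e1 := (abs_le.1 (hdisp n x)).2
    have e2 := (abs_le.1 (hdisp n y)).1
    change g₀ y - g₀ x ≤ _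
    linarith
  -- Truncating at `R = d(x,y)` leaves the value at `y` unchanged.
  refine ⟨⌈2 * B⌉₊, fun x y => ?_⟩
  have h2 := key x (graphDist K x y) x y
  rw [graphDist_self, Nat.zero_min, min_self, Nat.cast_zero, sub_zero] at h2
  exact_mod_cast h2.trans (Nat.le_ceil _)

end IsReversibleChain

/-! ### The weak transport cost -/

section Transport

theorem weakW2_le {d : X → X → ℕ} {ν μ : X → ℝ} {q p : X → X → ℝ} (hq : IsCoupling ν μ q)
    (hp : IsDisintegration ν q p) :
    weakW2 d ν μ ≤ (∑' x, (∑' y, (d x y : ℝ≥0∞) * ENNReal.ofReal (p x y)) ^ 2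
      * ENNReal.ofReal (ν x)) ^ (1 / 2 : ℝ) := by
  refine ENNReal.rpow_le_rpow ?_ (by norm_num)
  exact iInf_le_of_le q (iInf_le_of_le p (iInf_le_of_le hq (iInf_le_of_le hp le_rfl)))

theorem exists_of_weakW2_lt {d : X → X → ℕ} {ν μ : X → ℝ} {t : ℝ≥0∞} (h : weakW2 d ν μ < t) :
    ∃ q p : X → X → ℝ, IsCoupling ν μ q ∧ IsDisintegration ν q p ∧
      (∑' x, (∑' y, (d x y : ℝ≥0∞) * ENNReal.ofReal (p x y)) ^ 2
        * ENNReal.ofReal (ν x)) ^ (1 / 2 : ℝ) < t := by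
  by_contra! hcon
  refine absurd h (not_lt.2 ?_)
  have : t ^ (2 : ℝ) ≤ weakCost d ν μ := by
    refine le_iInf fun q => le_iInf fun p => le_iInf fun hq => le_iInf fun hp => ?_
    have := ENNReal.rpow_le_rpow (hcon q p hq hp) (by norm_num : (0 : ℝ) ≤ 2)
    rwa [← ENNReal.rpow_mul, div_mul_cancel₀ _ (by norm_num), ENNReal.rpow_one] at this
  have := ENNReal.rpow_le_rpow this (by norm_num : (0 : ℝ) ≤ 1 / 2)
  rwa [← ENNReal.rpow_mul, mul_one_div_cancel (by norm_num), ENNReal.rpow_one] at this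

/-- Minkowski's inequality for weighted sums. -/
theorem tsum_add_sq_rpow_le {ι : Type*} (a b w : ι → ℝ≥0∞) :
    (∑' i, (a i + b i) ^ 2 * w i) ^ (1 / 2 : ℝ)
      ≤ (∑' i, a i ^ 2 * w i) ^ (1 / 2 : ℝ) + (∑' i, b i ^ 2 * w i) ^ (1 / 2 : ℝ) := by
  let _ : MeasurableSpace ι := ⊤
  have h := ENNReal.lintegral_Lp_add_le (μ := MeasureTheory.Measure.count) (p := 2)
    (f := fun i => a i * w i ^ (1 / 2 : ℝ)) (g := fun i => b i * w i ^ (1 / 2 : ℝ))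
    (measurable_from_top.aemeasurable) (measurable_from_top.aemeasurable) (by norm_num)
  simp only [MeasureTheory.lintegral_count, Pi.add_apply, ← add_mul] at h
  have e : ∀ c x : ℝ≥0∞, (c * x ^ (1 / 2 : ℝ)) ^ (2 : ℝ) = c ^ 2 * x := fun c x => by
    rw [ENNReal.mul_rpow_of_nonneg _ _ (by norm_num), ← ENNReal.rpow_mul,
      div_mul_cancel₀ _ (by norm_num), ENNReal.rpow_one, ENNReal.rpow_two]
  simpa only [e] using h

/-- Jensen's inequality for the square. -/
theorem sq_tsum_mul_le {ι : Type*} (p b : ι → ℝ≥0∞) (hp : ∑' i, p i = 1) :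
    (∑' i, p i * b i) ^ 2 ≤ ∑' i, p i * b i ^ 2 := by
  let _ : MeasurableSpace ι := ⊤
  have h := ENNReal.lintegral_mul_le_Lp_mul_Lq MeasureTheory.Measure.count
    (Real.HolderConjugate.two_two) (f := fun i => p i ^ (1 / 2 : ℝ))
    (g := fun i => p i ^ (1 / 2 : ℝ) * b i)
    (measurable_from_top.aemeasurable) (measurable_from_top.aemeasurable)
  simp only [MeasureTheory.lintegral_count, Pi.mul_apply] at h
  have e1 : ∀ x : ℝ≥0∞, (x ^ (1 / 2 : ℝ)) ^ (2 : ℝ) = x := fun x => by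
    rw [← ENNReal.rpow_mul, div_mul_cancel₀ _ (by norm_num), ENNReal.rpow_one]
  have e2 : ∀ x c : ℝ≥0∞, (x ^ (1 / 2 : ℝ) * c) ^ (2 : ℝ) = x * c ^ 2 := fun x c => by
    rw [ENNReal.mul_rpow_of_nonneg _ _ (by norm_num), e1, ENNReal.rpow_two]
  have e3 : ∀ x c : ℝ≥0∞, x ^ (1 / 2 : ℝ) * (x ^ (1 / 2 : ℝ) * c) = x * c := fun x c => by
    rw [← mul_assoc, ← pow_two, ← ENNReal.rpow_two, e1]
  simp only [e1, e2, e3, hp, ENNReal.one_rpow, one_mul] at h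
  have h2 := ENNReal.rpow_le_rpow h (by norm_num : (0 : ℝ) ≤ 2)
  rwa [e1, ENNReal.rpow_two] at h2

theorem tsum_ofReal_eq {ι : Type*} {f : ι → ℝ} {a : ℝ} (h0 : ∀ i, 0 ≤ f i) (h : HasSum f a) :
    ∑' i, ENNReal.ofReal (f i) = ENNReal.ofReal a := by
  rw [← h.tsum_eq, ENNReal.ofReal_tsum_of_nonneg h0 h.summable]

theorem hasSum_of_tsum_ofReal {ι : Type*} {f : ι → ℝ} {a : ℝ} (h0 : ∀ i, 0 ≤ f i) (ha : 0 ≤ a)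
    (h : ∑' i, ENNReal.ofReal (f i) = ENNReal.ofReal a) : HasSum f a := by
  have htop : ∑' i, ENNReal.ofReal (f i) ≠ ∞ := h ▸ ENNReal.ofReal_ne_top
  have h2 := ENNReal.hasSum_toReal htop
  rw [← ENNReal.tsum_toReal_eq fun i => ENNReal.ofReal_ne_top, h, ENNReal.toReal_ofReal ha] at h2
  simpa only [ENNReal.toReal_ofReal (h0 _)] using h2

/-- The weak transport cost satisfies the triangle inequality, by composing kernels. -/
theorem weakW2_triangle {d : X → X → ℕ} (hd : ∀ x y z, d x z ≤ d x y + d y z) {ν₀ ν₁ ν₂ : X → ℝ}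
    (h₀ : ∀ x, 0 ≤ ν₀ x) (h₂ : ∀ x, 0 ≤ ν₂ x) :
    weakW2 d ν₀ ν₂ ≤ weakW2 d ν₀ ν₁ + weakW2 d ν₁ ν₂ := by
  rcases eq_or_ne (weakW2 d ν₀ ν₁) ∞ with ht | hA
  · rw [ht, top_add]; exact le_top
  rcases eq_or_ne (weakW2 d ν₁ ν₂) ∞ with ht | hB
  · rw [ht, add_top]; exact le_top
  refine ENNReal.le_of_forall_pos_le_add fun ε hε _ => ?_
  have hε2 : (ε / 2 : ℝ≥0∞) ≠ 0 := by simp [hε.ne']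
  obtain ⟨q, p, hq, hp, hlt⟩ := exists_of_weakW2_lt (ENNReal.lt_add_right hA hε2)
  obtain ⟨q', p', hq', hp', hlt'⟩ := exists_of_weakW2_lt (ENNReal.lt_add_right hB hε2)
  set P : X → X → ℝ≥0∞ := fun x y => ENNReal.ofReal (p x y) with hP
  set P' : X → X → ℝ≥0∞ := fun x y => ENNReal.ofReal (p' x y) with hP'
  have hP1 : ∀ x, ∑' y, P x y = 1 := fun x => by
    rw [hP, tsum_ofReal_eq (hp.nonneg x) (hp.sum x), ENNReal.ofReal_one]
  have hP1' : ∀ x, ∑' y, P' x y = 1 := fun x => by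
    rw [hP', tsum_ofReal_eq (hp'.nonneg x) (hp'.sum x), ENNReal.ofReal_one]
  have hmarg : ∀ y, ∑' x, P x y * ENNReal.ofReal (ν₀ x) = ENNReal.ofReal (ν₁ y) := fun y => by
    rw [← tsum_ofReal_eq (fun x => hq.nonneg x y) (hq.snd y)]
    exact tsum_congr fun x => by rw [hp.eq_mul, ENNReal.ofReal_mul (hp.nonneg x y)]
  have hmarg' : ∀ y, ∑' x, P' x y * ENNReal.ofReal (ν₁ x) = ENNReal.ofReal (ν₂ y) := fun y => by
    rw [← tsum_ofReal_eq (fun x => hq'.nonneg x y) (hq'.snd y)]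
    exact tsum_congr fun x => by rw [hp'.eq_mul, ENNReal.ofReal_mul (hp'.nonneg x y)]
  -- The glued kernel. Working in `ℝ≥0∞` allows free exchange of sums.
  set R : X → X → ℝ≥0∞ := fun x z => ∑' y, P x y * P' y z with hR
  have hR1 : ∀ x, ∑' z, R x z = 1 := fun x => by
    rw [hR, ENNReal.tsum_comm]
    simp only [ENNReal.tsum_mul_left, hP1', mul_one, hP1]
  have hRtop : ∀ x z, R x z ≠ ∞ := fun x z =>
    ne_top_of_le_ne_top ENNReal.one_ne_top (hR1 x ▸ ENNReal.le_tsum z)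
  have hRof : ∀ x z, ENNReal.ofReal (R x z).toReal = R x z := fun x z =>
    ENNReal.ofReal_toReal (hRtop x z)
  have hRmarg : ∀ z, ∑' x, R x z * ENNReal.ofReal (ν₀ x) = ENNReal.ofReal (ν₂ z) := fun z => by
    rw [← hmarg' z]
    simp only [hR, ← ENNReal.tsum_mul_right]
    rw [ENNReal.tsum_comm]
    refine tsum_congr fun y => ?_
    rw [← hmarg y, ← ENNReal.tsum_mul_left]
    exact tsum_congr fun x => by ring
  have hdis : IsDisintegration ν₀ (fun x z => (R x z).toReal * ν₀ x) fun x z => (R x z).toReal := by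
    refine ⟨fun x z => ENNReal.toReal_nonneg, fun x => ?_, fun x z => rfl⟩
    refine hasSum_of_tsum_ofReal (fun _ => ENNReal.toReal_nonneg) zero_le_one ?_
    simp only [hRof, hR1, ENNReal.ofReal_one]
  have hcoup : IsCoupling ν₀ ν₂ fun x z => (R x z).toReal * ν₀ x := by
    refine ⟨fun x z => mul_nonneg ENNReal.toReal_nonneg (h₀ x), fun x => ?_, fun z => ?_⟩
    · simpa using (hdis.sum x).mul_right (ν₀ x)
    · refine hasSum_of_tsum_ofReal (fun x => mul_nonneg ENNReal.toReal_nonneg (h₀ x)) (h₂ z) ?_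
      simp only [ENNReal.ofReal_mul ENNReal.toReal_nonneg, hRof, hRmarg]
  refine (weakW2_le hcoup hdis).trans ?_
  simp only [hRof]
  set a : X → ℝ≥0∞ := fun x => ∑' y, (d x y : ℝ≥0∞) * P x y with ha
  set b : X → ℝ≥0∞ := fun y => ∑' z, (d y z : ℝ≥0∞) * P' y z with hb
  have hle : ∀ x, ∑' z, (d x z : ℝ≥0∞) * R x z ≤ a x + ∑' y, P x y * b y := by
    intro x
    have e1 : a x = ∑' y, ∑' z, (d x y : ℝ≥0∞) * (P x y * P' y z) := by
      simp only [← mul_assoc, ENNReal.tsum_mul_left, hP1', mul_one, ha]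
    have e2 : ∑' y, P x y * b y = ∑' y, ∑' z, (d y z : ℝ≥0∞) * (P x y * P' y z) := by
      refine tsum_congr fun y => ?_
      rw [hb, ← ENNReal.tsum_mul_left]
      exact tsum_congr fun z => by ring
    simp only [hR, ← ENNReal.tsum_mul_left]
    rw [ENNReal.tsum_comm, e1, e2, ← ENNReal.tsum_add]
    refine ENNReal.tsum_le_tsum fun y => ?_
    rw [← ENNReal.tsum_add]
    refine ENNReal.tsum_le_tsum fun z => ?_
    rw [← add_mul]
    gcongr
    exact_mod_cast hd x y z
  calc _ ≤ (∑' x, (a x + ∑' y, P x y * b y) ^ 2 * ENNReal.ofReal (ν₀ x)) ^ (1 / 2 : ℝ) := by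
        gcongr with x; exact hle x
    _ ≤ _ := tsum_add_sq_rpow_le _ _ _
    _ ≤ (∑' x, a x ^ 2 * ENNReal.ofReal (ν₀ x)) ^ (1 / 2 : ℝ)
        + (∑' y, b y ^ 2 * ENNReal.ofReal (ν₁ y)) ^ (1 / 2 : ℝ) := by
      -- Conditioning on the first variable only lowers the second moment of `b`; the middle
      -- variable has law `ν₁`.
      refine add_le_add le_rfl (ENNReal.rpow_le_rpow ?_ (by norm_num))
      calc ∑' x, (∑' y, P x y * b y) ^ 2 * ENNReal.ofReal (ν₀ x)
          ≤ ∑' x, (∑' y, P x y * b y ^ 2) * ENNReal.ofReal (ν₀ x) :=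
            ENNReal.tsum_le_tsum fun x =>
              mul_le_mul_of_nonneg_right (sq_tsum_mul_le _ _ (hP1 x)) zero_le
        _ = ∑' y, b y ^ 2 * ENNReal.ofReal (ν₁ y) := by
          simp only [← ENNReal.tsum_mul_right]
          rw [ENNReal.tsum_comm]
          refine tsum_congr fun y => ?_
          rw [← hmarg y, ← ENNReal.tsum_mul_left]
          exact tsum_congr fun x => by ring
    _ ≤ (weakW2 d ν₀ ν₁ + ε / 2) + (weakW2 d ν₁ ν₂ + ε / 2) := add_le_add hlt.le hlt'.le
    _ = weakW2 d ν₀ ν₁ + weakW2 d ν₁ ν₂ + ε := by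
      rw [add_add_add_comm, ENNReal.add_halves]

/-- A coupling that moves the mass `t x y * ν x` from `x` to `y` and leaves the rest in place. -/
theorem weakW2_le_of_flow {d : X → X → ℕ} (hd : ∀ x, d x x = 0) {ν μ : X → ℝ} (hν : IsWeight ν)
    {t : X → X → ℝ} {s : X → ℝ} {D : ℕ} (ht : ∀ x y, 0 ≤ t x y) (hs : ∀ x, HasSum (t x) (s x))
    (hs1 : ∀ x, s x ≤ 1) (htd : ∀ x y, t x y ≠ 0 → d x y ≤ D)
    (hflow : ∀ y, HasSum (fun x => t x y * ν x) (μ y - (1 - s y) * ν y)) :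
    weakW2 d ν μ ≤ ENNReal.ofReal (D * √(wsum ν fun x => s x ^ 2)) := by
  classical
  have hs0 : ∀ x, 0 ≤ s x := fun x => (hs x).nonneg (ht x)
  set p : X → X → ℝ := fun x y => (if y = x then 1 - s x else 0) + t x y with hp
  have hp0 : ∀ x y, 0 ≤ p x y := fun x y => by
    refine add_nonneg ?_ (ht x y)
    split_ifs
    · linarith [hs1 x]
    · rfl
  have hdis : IsDisintegration ν (fun x y => p x y * ν x) p := by
    refine ⟨hp0, fun x => ?_, fun x y => rfl⟩
    have h := (hasSum_ite_eq x (1 - s x)).add (hs x)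
    rwa [sub_add_cancel] at h
  have hcoup : IsCoupling ν μ fun x y => p x y * ν x := by
    refine ⟨fun x y => mul_nonneg (hp0 x y) (hν.nonneg x), fun x => ?_, fun y => ?_⟩
    · simpa using (hdis.sum x).mul_right (ν x)
    · have h := (hasSum_ite_eq y ((1 - s y) * ν y)).add (hflow y)
      rw [add_sub_cancel] at h
      convert h using 1
      funext x
      rcases eq_or_ne x y with rfl | hxy
      · simp only [hp, if_true]; ring
      · simp only [hp, if_neg hxy, if_neg hxy.symm, zero_add]
  refine (weakW2_le hcoup hdis).trans ?_
  have hA : ∀ x, ∑' y, (d x y : ℝ≥0∞) * ENNReal.ofReal (p x y) ≤ ENNReal.ofReal (D * s x) := by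
    intro x
    rw [← tsum_ofReal_eq (fun y => mul_nonneg (Nat.cast_nonneg D) (ht x y)) ((hs x).mul_left (D : ℝ))]
    refine ENNReal.tsum_le_tsum fun y => ?_
    rw [← ENNReal.ofReal_natCast, ← ENNReal.ofReal_mul (Nat.cast_nonneg _)]
    refine ENNReal.ofReal_le_ofReal ?_
    rcases eq_or_ne y x with rfl | hyx
    · rw [hd, Nat.cast_zero, zero_mul]
      exact mul_nonneg (Nat.cast_nonneg _) (ht _ _)
    · simp only [hp, if_neg hyx, zero_add]
      rcases eq_or_ne (t x y) 0 with h0 | h0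
      · simp [h0]
      · exact mul_le_mul_of_nonneg_right (Nat.cast_le.2 (htd x y h0)) (ht x y)
  have hsb : Bdd s := Bdd.of_mem_Icc fun x => ⟨hs0 x, hs1 x⟩
  calc _ ≤ (∑' x, ENNReal.ofReal (D * s x) ^ 2 * ENNReal.ofReal (ν x)) ^ (1 / 2 : ℝ) := by
        gcongr with x; exact hA x
    _ = (ENNReal.ofReal (D ^ 2 * wsum ν fun x => s x ^ 2)) ^ (1 / 2 : ℝ) := by
      congr 1
      rw [← wsum_const_mul]
      unfold wsum
      rw [ENNReal.ofReal_tsum_of_nonneg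
        (fun x => mul_nonneg (mul_nonneg (by positivity) (sq_nonneg _)) (hν.nonneg x))
        (hν.summable_mul ((Bdd.const _).mul hsb.sq))]
      refine tsum_congr fun x => ?_
      rw [← ENNReal.ofReal_pow (mul_nonneg (Nat.cast_nonneg _) (hs0 x)),
        ← ENNReal.ofReal_mul (by positivity), mul_pow]
    _ = _ := by
      rw [ENNReal.ofReal_rpow_of_nonneg
        (mul_nonneg (by positivity) (hν.wsum_nonneg fun x => sq_nonneg _)) (by norm_num),
        ← Real.sqrt_eq_rpow, Real.sqrt_mul (by positivity), Real.sqrt_sq (Nat.cast_nonneg _)]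

/-- For a bounded distance, the weak transport cost is controlled by the total variation. -/
theorem weakW2_le_of_bounded {d : X → X → ℕ} (hd : ∀ x, d x x = 0) {D : ℕ}
    (hD : ∀ x y, d x y ≤ D) {ν μ : X → ℝ} (hν0 : ∀ x, 0 ≤ ν x) (hμ0 : ∀ x, 0 ≤ μ x)
    (hν : HasSum ν 1) (hμ : HasSum μ 1) :
    weakW2 d ν μ ≤ ENNReal.ofReal (D * √(∑' x, |ν x - μ x|)) := by
  have hsub : Summable fun x => |ν x - μ x| := (hν.summable.sub hμ.summable).abs
  -- The excess `a` and the deficit `b` have the same mass `m`; each point sends its excess out in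
  -- proportion to `b`.
  set a : X → ℝ := fun x => max (ν x - μ x) 0 with ha
  set b : X → ℝ := fun x => max (μ x - ν x) 0 with hb
  have ha0 : ∀ x, 0 ≤ a x := fun x => le_max_right _ _
  have hb0 : ∀ x, 0 ≤ b x := fun x => le_max_right _ _
  have hale : ∀ x, a x ≤ |ν x - μ x| := fun x => max_le (le_abs_self _) (abs_nonneg _)
  have haν : ∀ x, a x ≤ ν x := fun x => max_le (by linarith [hμ0 x]) (hν0 x)
  have hab : ∀ x, a x - b x = ν x - μ x := fun x => by
    rw [ha, hb]; simp only
    rcases le_total (ν x) (μ x) with h | h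
    · rw [max_eq_right (by linarith), max_eq_left (by linarith)]; ring
    · rw [max_eq_left (by linarith), max_eq_right (by linarith)]; ring
  have has : Summable a := Summable.of_nonneg_of_le ha0 hale hsub
  have hbs : Summable b := by
    have := has.sub (hν.summable.sub hμ.summable)
    refine this.congr fun x => ?_
    linarith [hab x]
  set m : ℝ := ∑' x, a x with hm
  have hbm : ∑' x, b x = m := by
    have h1 := has.tsum_sub hbs
    simp only [hab] at h1
    rw [hν.summable.tsum_sub hμ.summable, hν.tsum_eq, hμ.tsum_eq] at h1
    linarith
  have hm0 : m = 0 → (∀ x, a x = 0) ∧ ∀ x, b x = 0 := fun h => by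
    refine ⟨fun x => ?_, fun x => ?_⟩
    · exact le_antisymm ((has.le_tsum x fun y _ => ha0 y).trans h.le) (ha0 x)
    · exact le_antisymm ((hbs.le_tsum x fun y _ => hb0 y).trans (hbm.trans h).le) (hb0 x)
  have hmnn : 0 ≤ m := tsum_nonneg ha0
  -- Where `ν x = 0`, also `a x = 0`, so the default value of the quotient is harmless.
  have hcancel : ∀ x, a x / ν x * ν x = a x := fun x => by
    rcases eq_or_ne (ν x) 0 with h | h
    · rw [h, mul_zero]
      exact le_antisymm (ha0 x) (h ▸ haν x)
    · exact div_mul_cancel₀ _ h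
  have hflow := weakW2_le_of_flow (μ := μ) hd ⟨hν0, hν.summable⟩
    (t := fun x y => a x / ν x * (b y / m)) (s := fun x => a x / ν x) (D := D)
    (fun x y => mul_nonneg (div_nonneg (ha0 x) (hν0 x)) (div_nonneg (hb0 y) hmnn))
    (fun x => by
      have h := ((hbs.hasSum.div_const m).mul_left (a x / ν x))
      rw [hbm] at h
      rcases eq_or_ne m 0 with h0 | h0
      · simp [(hm0 h0).1 x]
      · rwa [div_self h0, mul_one] at h)
    (fun x => div_le_one_of_le₀ (haν x) (hν0 x)) (fun x y _ => hD x y)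
    (fun y => by
      have h := has.hasSum.mul_right (b y / m)
      have e1 : m * (b y / m) = b y := by
        rcases eq_or_ne m 0 with h0 | h0
        · simp [h0, (hm0 h0).2 y]
        · rw [mul_div_cancel₀ _ h0]
      rw [← hm, e1] at h
      have e2 : μ y - (1 - a y / ν y) * ν y = b y := by
        rw [sub_mul, hcancel, one_mul]
        linarith [hab y]
      rw [e2]
      simpa only [mul_right_comm _ (b y / m), hcancel] using h)
  refine hflow.trans (ENNReal.ofReal_le_ofReal ?_)
  refine mul_le_mul_of_nonneg_left (Real.sqrt_le_sqrt ?_) (Nat.cast_nonneg _)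
  have hle : ∀ x, (a x / ν x) ^ 2 * ν x ≤ |ν x - μ x| := fun x => by
    have e : (a x / ν x) ^ 2 * ν x = a x / ν x * a x := by
      rw [pow_two, mul_assoc, hcancel]
    rw [e]
    exact (mul_le_of_le_one_left (ha0 x) (div_le_one_of_le₀ (haν x) (hν0 x))).trans (hale x)
  exact (Summable.of_nonneg_of_le (fun x => mul_nonneg (sq_nonneg _) (hν0 x)) hle hsub).tsum_le_tsum
    hle hsub

end Transport

/-! ### Transport along the Euler scheme and passage to the limit -/

namespace IsReversibleChain

variable (hK : IsReversibleChain K π)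
include hK

theorem bddAbove_laziness : BddAbove (Set.range fun x => 1 - K x x) :=
  ⟨1, by rintro _ ⟨x, rfl⟩; linarith [hK.kernel_nonneg x x]⟩

theorem le_laziness (x : X) : 1 - K x x ≤ laziness K := le_ciSup hK.bddAbove_laziness x

theorem laziness_le_one : laziness K ≤ 1 :=
  Real.iSup_le (fun x => by linarith [hK.kernel_nonneg x x]) zero_le_one

theorem kernel_le_one (x y : X) : K x y ≤ 1 :=
  hK.tsum_kernel x ▸ (hK.kernel_sum x).summable.le_tsum y fun z _ => hK.kernel_nonneg x z

theorem laziness_nonneg : 0 ≤ laziness K :=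
  Real.iSup_nonneg fun x => by linarith [hK.kernel_le_one x x]

/-- The Cauchy-Schwarz inequality for functions vanishing at the starting point. -/
theorem wsum_kernel_sq_le {F : X → ℝ} (hF : Bdd F) {x : X} (hx : F x = 0) :
    wsum (K x) F ^ 2 ≤ laziness K * wsum (K x) fun y => F y ^ 2 := by
  classical
  -- Deleting the holding mass leaves weights of total mass `1 - K(x,x)`; this is the source of the
  -- factor `J`.
  set k : X → ℝ := fun y => K x y - if y = x then K x x else 0 with hk
  have hsum : HasSum k (1 - K x x) := (hK.kernel_sum x).sub (hasSum_ite_eq x (K x x))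
  have hkw : IsWeight k := ⟨fun y => by
    simp only [hk]
    split_ifs with h
    · rw [h, sub_self]
    · rw [sub_zero]; exact hK.kernel_nonneg x y, hsum.summable⟩
  have heq : ∀ G : X → ℝ, G x = 0 → wsum k G = wsum (K x) G := fun G hG => by
    refine tsum_congr fun y => ?_
    simp only [hk]
    split_ifs with h
    · simp [h, hG]
    · rw [sub_zero]
  have h := hkw.wsum_sq_le hF
  rw [heq F hx, heq _ (by simp [hx]), hsum.tsum_eq] at h
  exact h.trans (mul_le_mul_of_nonneg_right (hK.le_laziness x)
    ((hK.isWeight_kernel x).wsum_nonneg fun y => sq_nonneg _))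

/-- Reversing an edge exchanges positive and negative parts of the difference, so each carries half
of the squared sum. This matches the `½` in `Γ`, and one-sided currents cost no extra factor. -/
theorem wsum_edgeWeight_max_sq {u : X → ℝ} (hu : Bdd u) :
    wsum (edgeWeight K π) (fun z => max (u z.1 - u z.2) 0 ^ 2) = energy K π u u := by
  have hb : Bdd fun z : X × X => max (u z.1 - u z.2) 0 ^ 2 :=
    ((hu.comp Prod.fst).sub (hu.comp Prod.snd)).max_zero.sq
  have h1 := hK.wsum_edgeWeight_swap fun z => max (u z.1 - u z.2) 0 ^ 2
  have h2 := hK.isWeight_edgeWeight.wsum_add (hb.comp Prod.swap) hb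
  have h3 : (fun z : X × X => max (u z.swap.1 - u z.swap.2) 0 ^ 2 + max (u z.1 - u z.2) 0 ^ 2)
      = fun z => (u z.2 - u z.1) * (u z.2 - u z.1) := by
    funext z
    simp only [Prod.fst_swap, Prod.snd_swap]
    rcases le_total (u z.1) (u z.2) with h | h
    · rw [max_eq_right (b := (0 : ℝ)) (a := u z.1 - u z.2) (by linarith), max_eq_left (by linarith)]
      ring
    · rw [max_eq_left (b := (0 : ℝ)) (a := u z.1 - u z.2) (by linarith), max_eq_right (by linarith)]
      ring
  rw [h3, h1] at h2
  rw [hK.energy_eq hu hu, h2]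
  ring

/-- The weak transport cost of one step of the Euler scheme. -/
theorem weakW2_euler_le {f : X → ℝ} {a b : ℝ} (ha : 0 < a) (hf : ∀ x, f x ∈ Set.Icc a b)
    {h : ℝ} (h0 : 0 ≤ h) (h1 : h ≤ 1) :
    weakW2 (graphDist K) (fun x => f x * π x) (fun x => (f x + h * gen K f x) * π x)
      ≤ ENNReal.ofReal (h * √(4 * laziness K * energy K π (fun x => √(f x)) fun x => √(f x))) := by
  have hfb := Bdd.of_mem_Icc hf
  have hpos : ∀ x, 0 < f x := fun x => ha.trans_le (hf x).1
  set u : X → ℝ := fun x => √(f x) with hu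
  have hupos : ∀ x, 0 < u x := fun x => Real.sqrt_pos.2 (hpos x)
  have husq : ∀ x, u x ^ 2 = f x := fun x => Real.sq_sqrt (hpos x).le
  have hub : Bdd u := Bdd.of_mem_Icc (a := 0) (b := √b) fun x =>
    ⟨(hupos x).le, Real.sqrt_le_sqrt (hf x).2⟩
  have hmb : ∀ x, Bdd fun y => max (f x - f y) 0 := fun x => ((Bdd.const _).sub hfb).max_zero
  set S : X → ℝ := fun x => wsum (K x) fun y => max (f x - f y) 0 with hS
  have hSle : ∀ x, S x ≤ f x := fun x => by
    have := (hK.isWeight_kernel x).wsum_mono (hmb x) (Bdd.const (f x)) fun y =>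
      max_le (by linarith [hpos y]) (hpos x).le
    rwa [wsum_const, hK.tsum_kernel, mul_one] at this
  have hS0 : ∀ x, 0 ≤ S x := fun x => (hK.isWeight_kernel x).wsum_nonneg fun y => le_max_right _ _
  have hw : IsWeight fun x => f x * π x :=
    ⟨fun x => mul_nonneg (hpos x).le (hK.prob_nonneg x), hK.isWeight_prob.summable_mul hfb⟩
  -- Across each edge only the net current `h (f x - f y)₊ K(x,y) π x` is moved, from the larger to
  -- the smaller value of `f`. All moves have length at most one, and detailed balance yields the
  -- correct final marginal.
  have hflow := weakW2_le_of_flow (d := graphDist K) (μ := fun x => (f x + h * gen K f x) * π x)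
    graphDist_self hw (t := fun x y => h / f x * (max (f x - f y) 0 * K x y))
    (s := fun x => h / f x * S x) (D := 1)
    (fun x y => mul_nonneg (div_nonneg h0 (hpos x).le)
      (mul_nonneg (le_max_right _ _) (hK.kernel_nonneg x y)))
    (fun x => ((hK.isWeight_kernel x).summable_mul (hmb x)).hasSum.mul_left _)
    (fun x => by
      rw [div_mul_eq_mul_div, div_le_one (hpos x)]
      nlinarith [hSle x, hS0 x])
    (fun x y hxy => by
      refine graphDist_le_one ((hK.kernel_nonneg x y).lt_of_ne fun h => hxy ?_)
      simp [← h])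
    (fun y => by
      have hb' : Bdd fun x => max (f x - f y) 0 := (hfb.sub (Bdd.const _)).max_zero
      have e := ((hK.isWeight_kernel y).summable_mul hb').hasSum.mul_left (h * π y)
      have e1 : wsum (K y) (fun x => max (f x - f y) 0) = gen K f y + S y := by
        rw [gen_eq, hS]
        simp only
        rw [← (hK.isWeight_kernel y).wsum_add (hfb.sub (Bdd.const _)) (hmb y)]
        congr 1; funext x
        rcases le_total (f x) (f y) with h | h
        · rw [max_eq_right (by linarith), max_eq_left (by linarith)]; ring
        · rw [max_eq_left (by linarith), max_eq_right (by linarith)]; ring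
      have e2 : (f y + h * gen K f y) * π y - (1 - h / f y * S y) * (f y * π y)
          = h * π y * (gen K f y + S y) := by
        have := (hpos y).ne'
        field_simp
        ring
      change HasSum _ (h * π y * wsum (K y) fun x => max (f x - f y) 0) at e
      rw [e1, ← e2] at e
      convert e using 1
      funext x
      have hdb := hK.detailed_balance x y
      have := (hpos x).ne'
      field_simp
      linear_combination (h * max (f x - f y) 0) * hdb)
  refine hflow.trans (ENNReal.ofReal_le_ofReal ?_)
  rw [Nat.cast_one, one_mul]
  have hub2 : Bdd fun z : X × X => max (u z.1 - u z.2) 0 ^ 2 :=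
    ((hub.comp Prod.fst).sub (hub.comp Prod.snd)).max_zero.sq
  have hpt : ∀ x, (h / f x * S x) ^ 2 * f x
      ≤ h ^ 2 * (4 * laziness K) * wsum (K x) fun y => max (u x - u y) 0 ^ 2 := by
    intro x
    have hmx : Bdd fun y => max (u x - u y) 0 := ((Bdd.const _).sub hub).max_zero
    -- When `u y ≤ u x`, `u x² - u y² ≤ 2 u x (u x - u y)`. The factor `u x` cancels the density in
    -- `S² / f`.
    have e1 : S x ≤ 2 * u x * wsum (K x) fun y => max (u x - u y) 0 := by
      rw [← wsum_const_mul]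
      refine (hK.isWeight_kernel x).wsum_mono (hmb x) ((Bdd.const _).mul hmx) fun y => ?_
      rcases le_total (u x) (u y) with h | h
      · have : f x ≤ f y := by
          rw [← husq, ← husq]; exact pow_le_pow_left₀ (hupos x).le h 2
        rw [max_eq_right (by linarith), max_eq_right (by linarith), mul_zero]
      · have : f y ≤ f x := by
          rw [← husq, ← husq]; exact pow_le_pow_left₀ (hupos y).le h 2
        rw [max_eq_left (by linarith), max_eq_left (by linarith), ← husq, ← husq]
        nlinarith
    have e2 := pow_le_pow_left₀ (hS0 x) e1 2
    have e3 := hK.wsum_kernel_sq_le (x := x) hmx (by simp)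
    have e4 : (h / f x * S x) ^ 2 * f x = h ^ 2 * (S x ^ 2 / f x) := by
      have := (hpos x).ne'
      field_simp
    rw [e4, mul_assoc]
    refine mul_le_mul_of_nonneg_left ?_ (sq_nonneg h)
    rw [div_le_iff₀ (hpos x)]
    rw [mul_pow, mul_pow, husq] at e2
    have e5 := mul_le_mul_of_nonneg_left e3 (by linarith [hpos x] : 0 ≤ 4 * f x)
    linarith
  have hsb : Bdd fun x => h / f x * S x := Bdd.of_mem_Icc (a := 0) (b := 1) fun x =>
    ⟨mul_nonneg (div_nonneg h0 (hpos x).le) (hS0 x), by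
      rw [div_mul_eq_mul_div, div_le_one (hpos x)]
      nlinarith [hSle x, hS0 x]⟩
  have hcost : wsum (fun x => f x * π x) (fun x => (h / f x * S x) ^ 2)
      ≤ h ^ 2 * (4 * laziness K * energy K π u u) := by
    have e1 : wsum (fun x => f x * π x) (fun x => (h / f x * S x) ^ 2)
        = wsum π fun x => (h / f x * S x) ^ 2 * f x := tsum_congr fun x => by ring
    rw [e1, ← hK.wsum_edgeWeight_max_sq hub, hK.wsum_edgeWeight hub2, ← mul_assoc, ← wsum_const_mul]
    exact hK.isWeight_prob.wsum_mono (hsb.sq.mul hfb)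
      ((Bdd.const _).mul (hK.bdd_wsum_kernel hub2)) hpt
  calc _ ≤ √(h ^ 2 * (4 * laziness K * energy K π u u)) := Real.sqrt_le_sqrt hcost
    _ = _ := by rw [Real.sqrt_mul (sq_nonneg h), Real.sqrt_sq h0]

/-- Densities whose increments along edges tend to zero converge to `1` in `L¹(π)`. -/
theorem tendsto_tsum_abs_sub {g : ℕ → X → ℝ} {b : ℝ} (hb : ∀ n x, g n x ∈ Set.Icc 0 b)
    (h1 : ∀ n, wsum π (g n) = 1)
    (hedge : ∀ x y, 0 < K x y → Tendsto (fun n => g n y - g n x) atTop (𝓝 0)) :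
    Tendsto (fun n => ∑' x, |g n x * π x - π x|) atTop (𝓝 0) := by
  have hgb : ∀ n, Bdd (g n) := fun n => Bdd.of_mem_Icc (hb n)
  have habs : ∀ n x y, |g n x - g n y| ≤ b := fun n x y => by
    rw [abs_le]
    constructor <;> linarith [(hb n x).1, (hb n x).2, (hb n y).1, (hb n y).2]
  have hpt : ∀ x, Tendsto (fun n => g n x - 1) atTop (𝓝 0) := by
    intro x
    -- Unit mean turns convergence of differences into convergence to `1`.
    have e : ∀ n, g n x - 1 = ∑' y, (g n x - g n y) * π y := fun n => by
      have := hK.isWeight_prob.wsum_sub (Bdd.const (g n x)) (hgb n)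
      rw [wsum_const, hK.tsum_prob, mul_one, h1] at this
      exact this.symm
    simp only [e]
    have h0 : (0 : ℝ) = ∑' y, 0 * π y := by simp
    rw [h0]
    refine tendsto_tsum_of_dominated_convergence (bound := fun y => b * π y)
      (hK.prob_sum.summable.mul_left b) (fun y => ?_) (Eventually.of_forall fun n y => ?_)
    · exact (hK.tendsto_sub_of_edge hedge y x).mul_const _
    · rw [Real.norm_eq_abs, abs_mul, abs_of_nonneg (hK.prob_nonneg y)]
      exact mul_le_mul_of_nonneg_right (habs n x y) (hK.prob_nonneg y)
  have h0 : (0 : ℝ) = ∑' x : X, (0 : ℝ) := by simp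
  rw [h0]
  refine tendsto_tsum_of_dominated_convergence (bound := fun y => (b + 1) * π y)
    (hK.prob_sum.summable.mul_left _) (fun x => ?_) (Eventually.of_forall fun n x => ?_)
  · have := ((hpt x).mul_const (π x)).abs
    simpa [sub_mul] using this
  · have e : g n x * π x - π x = (g n x - 1) * π x := by ring
    rw [Real.norm_eq_abs, abs_abs, e, abs_mul, abs_of_nonneg (hK.prob_nonneg x)]
    refine mul_le_mul_of_nonneg_right ?_ (hK.prob_nonneg x)
    rw [abs_le]
    constructor <;> linarith [(hb n x).1, (hb n x).2]

/-- The weak transport-information inequality for densities bounded from above and below. -/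
theorem weakW2_le_of_bounded_density {κ : ℝ} (hκ : 0 < κ) (hCDE : CDEprime K κ) {f : X → ℝ}
    {a b : ℝ} (ha : 0 < a) (hf : ∀ x, f x ∈ Set.Icc a b) (hf1 : wsum π f = 1) :
    weakW2 (graphDist K) (fun x => f x * π x) π
      ≤ ENNReal.ofReal (4 / (3 * κ)
          * √(4 * laziness K * energy K π (fun x => √(f x)) fun x => √(f x))) := by
  obtain ⟨C, hC0, hC⟩ := hK.energy_sqrt_euler_le hCDE (α := √a) (β := √b) (Real.sqrt_pos.2 ha)
  obtain ⟨D, hD⟩ := hK.exists_graphDist_le hκ hCDE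
  -- The three bounds respectively keep each step an average, absorb `C h²` into `κh/2`, and ensure
  -- `r ≥ 0`.
  set h : ℝ := min 1 (min (κ / (2 * C)) (1 / κ)) with hh
  have h0 : 0 < h := by positivity
  have h1 : h ≤ 1 := min_le_left _ _
  have hhC : C * h ≤ κ / 2 := by
    have := mul_le_mul_of_nonneg_left
      ((min_le_right 1 (min (κ / (2 * C)) (1 / κ))).trans (min_le_left _ _)) hC0.le
    have e : C * (κ / (2 * C)) = κ / 2 := by field_simp
    rwa [e] at this
  have hhκ : κ * h ≤ 1 := by
    have := mul_le_mul_of_nonneg_left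
      ((min_le_right 1 (min (κ / (2 * C)) (1 / κ))).trans (min_le_right _ _)) hκ.le
    rwa [mul_one_div_cancel hκ.ne'] at this
  -- After absorption the factor is at most `1 - (3/2)κh ≤ r²`.
  set r : ℝ := 1 - 3 / 4 * (κ * h) with hr
  have hκh : 0 < κ * h := mul_pos hκ h0
  have hr0 : 0 ≤ r := by linarith
  have hr1 : r < 1 := by linarith
  have hrsq : 1 - 2 * κ * h + C * h ^ 2 ≤ r ^ 2 := by
    have := mul_le_mul_of_nonneg_right hhC h0.le
    nlinarith [sq_nonneg (κ * h)]
  set S : (X → ℝ) → X → ℝ := fun g z => g z + h * gen K g z with hS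
  set g : ℕ → X → ℝ := fun n => S^[n] f with hg
  have hgs : ∀ n, g (n + 1) = fun z => g n z + h * gen K (g n) z := by
    intro n
    rw [hg]; simp only
    rw [Function.iterate_succ_apply']
  have hgI : ∀ n x, g n x ∈ Set.Icc a b := by
    intro n
    induction n with
    | zero => exact hf
    | succ n ih => rw [hgs]; exact hK.euler_mem_Icc ih h0.le h1
  have hgb : ∀ n, Bdd (g n) := fun n => Bdd.of_mem_Icc (hgI n)
  have hg1 : ∀ n, wsum π (g n) = 1 := by
    intro n
    induction n with
    | zero => exact hf1
    | succ n ih => rw [hgs, hK.wsum_euler (hgb n), ih]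
  have hgnn : ∀ n x, 0 ≤ g n x := fun n x => ha.le.trans (hgI n x).1
  set u : ℕ → X → ℝ := fun n x => √(g n x) with hu
  have husq : ∀ n x, u n x ^ 2 = g n x := fun n x => Real.sq_sqrt (hgnn n x)
  have huI : ∀ n x, u n x ∈ Set.Icc √a √b := fun n x =>
    ⟨Real.sqrt_le_sqrt (hgI n x).1, Real.sqrt_le_sqrt (hgI n x).2⟩
  have hub : ∀ n, Bdd (u n) := fun n => Bdd.of_mem_Icc (huI n)
  set E : ℝ := energy K π (u 0) (u 0) with hE
  have hEn : ∀ n, energy K π (u n) (u n) ≤ (r ^ n) ^ 2 * E := by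
    intro n
    induction n with
    | zero => simp [hE]
    | succ n ih =>
      have e1 : u (n + 1) = fun x => √(u n x ^ 2 + h * gen K (fun y => u n y ^ 2) x) := by
        simp only [husq]
        simp only [hu, hgs]
      have e2 := hC h h0 h1 (u n) (huI n)
      rw [← e1] at e2
      refine e2.trans ((mul_le_mul_of_nonneg_right hrsq (hK.energy_nonneg _)).trans ?_)
      calc r ^ 2 * energy K π (u n) (u n) ≤ r ^ 2 * ((r ^ n) ^ 2 * E) :=
            mul_le_mul_of_nonneg_left ih (sq_nonneg r)
        _ = _ := by ring
  set M : ℝ := √(4 * laziness K * E) with hM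
  have hJ := hK.laziness_nonneg
  have hstep : ∀ n, weakW2 (graphDist K) (fun x => g n x * π x) (fun x => g (n + 1) x * π x)
      ≤ ENNReal.ofReal (h * r ^ n * M) := by
    intro n
    rw [hgs]
    refine (hK.weakW2_euler_le ha (hgI n) h0.le h1).trans (ENNReal.ofReal_le_ofReal ?_)
    rw [mul_assoc h]
    refine mul_le_mul_of_nonneg_left ?_ h0.le
    have e : r ^ n * M = √((r ^ n) ^ 2 * (4 * laziness K * E)) := by
      rw [Real.sqrt_mul (sq_nonneg _), Real.sqrt_sq (pow_nonneg hr0 n)]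
    rw [e]
    refine Real.sqrt_le_sqrt ?_
    have := mul_le_mul_of_nonneg_left (hEn n) (by positivity : 0 ≤ 4 * laziness K)
    linarith
  have hchain : ∀ n, weakW2 (graphDist K) (fun x => f x * π x) π
      ≤ ENNReal.ofReal (∑ i ∈ Finset.range n, h * r ^ i * M)
        + weakW2 (graphDist K) (fun x => g n x * π x) π := by
    intro n
    induction n with
    | zero => simp [hg]
    | succ n ih =>
      refine ih.trans ?_
      rw [Finset.sum_range_succ, ENNReal.ofReal_add
        (Finset.sum_nonneg fun i _ => by positivity) (by positivity), add_assoc]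
      refine add_le_add le_rfl ?_
      refine (weakW2_triangle hK.graphDist_triangle
        (fun x => mul_nonneg (hgnn n x) (hK.prob_nonneg x)) hK.prob_nonneg).trans
        (add_le_add (hstep n) le_rfl)
  have hsum : ∀ n, ∑ i ∈ Finset.range n, h * r ^ i * M ≤ 4 / (3 * κ) * M := by
    intro n
    rw [← Finset.sum_mul, ← Finset.mul_sum]
    refine mul_le_mul_of_nonneg_right ?_ (Real.sqrt_nonneg _)
    have e1 := (summable_geometric_of_lt_one hr0 hr1).sum_le_tsum (Finset.range n)
      fun i _ => pow_nonneg hr0 i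
    rw [tsum_geometric_of_lt_one hr0 hr1] at e1
    have e2 : h * (1 - r)⁻¹ = 4 / (3 * κ) := by
      have : 1 - r = 3 / 4 * (κ * h) := by rw [hr]; ring
      rw [this]
      field_simp
    rw [← e2]
    exact mul_le_mul_of_nonneg_left e1 h0.le
  have hres : Tendsto (fun n => ∑' x, |g n x * π x - π x|) atTop (𝓝 0) := by
    refine hK.tendsto_tsum_abs_sub (b := b) (fun n x => ⟨hgnn n x, (hgI n x).2⟩) hg1 ?_
    intro x y hxy
    have hQ : 0 < edgeWeight K π (x, y) := mul_pos hxy (hK.prob_pos x)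
    have hrn : Tendsto (fun n => r ^ n) atTop (𝓝 0) := tendsto_pow_atTop_nhds_zero_of_lt_one hr0 hr1
    -- A single edge of positive weight is controlled by the whole energy, and `u n ≤ √b` transfers
    -- this from `u n` to its square.
    have hle : ∀ n, |g n y - g n x| ≤ 2 * √b * (r ^ n * √(2 * E / edgeWeight K π (x, y))) := by
      intro n
      have e1 := hK.isWeight_edgeWeight.le_wsum (bdd_edge (hub n) (hub n))
        (fun z => mul_self_nonneg _) (x, y)
      have e2 := hEn n
      rw [hK.energy_eq (hub n) (hub n)] at e2
      have e3 : |u n y - u n x| ≤ r ^ n * √(2 * E / edgeWeight K π (x, y)) := by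
        refine abs_le_of_sq_le_sq ?_ (by positivity)
        have hE0 : 0 ≤ E := hK.energy_nonneg _
        rw [mul_pow, Real.sq_sqrt (by positivity), ← mul_div_assoc, le_div_iff₀ hQ]
        simp only at e1
        nlinarith
      have e4 : g n y - g n x = (u n y + u n x) * (u n y - u n x) := by
        rw [← husq, ← husq]; ring
      rw [e4, abs_mul, abs_of_nonneg (add_nonneg (Real.sqrt_nonneg _) (Real.sqrt_nonneg _))]
      exact mul_le_mul (by linarith [(huI n x).2, (huI n y).2]) e3 (abs_nonneg _) (by positivity)
    refine squeeze_zero_norm hle ?_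
    simpa using (hrn.mul_const (√(2 * E / edgeWeight K π (x, y)))).const_mul (2 * √b)
  have hbound : ∀ n, weakW2 (graphDist K) (fun x => f x * π x) π
      ≤ ENNReal.ofReal (4 / (3 * κ) * M + D * √(∑' x, |g n x * π x - π x|)) := by
    intro n
    rw [ENNReal.ofReal_add (by positivity) (by positivity)]
    refine (hchain n).trans (add_le_add (ENNReal.ofReal_le_ofReal (hsum n)) ?_)
    refine weakW2_le_of_bounded graphDist_self hD
      (fun x => mul_nonneg (hgnn n x) (hK.prob_nonneg x)) hK.prob_nonneg ?_ hK.prob_sum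
    rw [← hg1 n]
    exact (hK.isWeight_prob.summable_mul (hgb n)).hasSum
  have hlim : Tendsto (fun n => 4 / (3 * κ) * M + D * √(∑' x, |g n x * π x - π x|)) atTop
      (𝓝 (4 / (3 * κ) * M + D * √0)) := ((hres.sqrt).const_mul _).const_add _
  rw [Real.sqrt_zero, mul_zero, add_zero] at hlim
  exact ge_of_tendsto' (ENNReal.tendsto_ofReal hlim) hbound

/-- Contractions of the square root of a density have a smaller energy. -/
theorem energy_le_of_density {f v : X → ℝ} (hf : IsDensity π f) (hv : Bdd v)
    (h : ∀ x y, |v y - v x| ≤ |√(f y) - √(f x)|) :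
    energy K π v v ≤ energy K π (fun x => √(f x)) fun x => √(f x) := by
  have hsq : ∀ x y, (v y - v x) * (v y - v x)
      ≤ (√(f y) - √(f x)) * (√(f y) - √(f x)) := fun x y => by
    simpa only [← pow_two, sq_abs] using pow_le_pow_left₀ (abs_nonneg _) (h x y) 2
  have hle : ∀ x y, (√(f y) - √(f x)) * (√(f y) - √(f x)) ≤ f x + f y := fun x y => by
    nlinarith [Real.sq_sqrt (hf.nonneg x), Real.sq_sqrt (hf.nonneg y),
      mul_nonneg (Real.sqrt_nonneg (f x)) (Real.sqrt_nonneg (f y))]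
  -- As `√f` may be unbounded, summability must be proved: the default value `0` of a divergent
  -- `tsum` would not bound the energy of `v`.
  have hQ : Summable fun z : X × X => (√(f z.2) - √(f z.1)) * (√(f z.2) - √(f z.1))
      * edgeWeight K π z := by
    refine Summable.of_nonneg_of_le
      (fun z => mul_nonneg (mul_self_nonneg _) (hK.edgeWeight_nonneg z)) (fun z => ?_)
      ((hK.summable_fst hf.nonneg hf.sum.summable).add
        (hK.summable_snd hf.nonneg hf.sum.summable))
    rw [← add_mul]
    exact mul_le_mul_of_nonneg_right (hle z.1 z.2) (hK.edgeWeight_nonneg z)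
  have hrow : ∀ x, Summable fun y => (√(f y) - √(f x)) * (√(f y) - √(f x)) * K x y := by
    intro x
    have := (hQ.prod_factor x).mul_right (π x)⁻¹
    refine this.congr fun y => ?_
    have := (hK.prob_pos x).ne'
    simp only [edgeWeight]
    field_simp
  have hG : Summable fun x => Gam K (fun z => √(f z)) (fun z => √(f z)) x * π x := by
    refine (hQ.prod.mul_left (1 / 2)).congr fun x => ?_
    rw [Gam, mul_assoc, ← tsum_mul_right]
    simp only [edgeWeight, mul_assoc]
  refine (hK.isWeight_prob.summable_mul (hK.bdd_Gam hv hv)).tsum_le_tsum (fun x => ?_) hG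
  refine mul_le_mul_of_nonneg_right ?_ (hK.prob_nonneg x)
  have hvx : Bdd fun y => v y - v x := hv.sub (Bdd.const _)
  exact mul_le_mul_of_nonneg_left (((hK.isWeight_kernel x).summable_mul (hvx.mul hvx)).tsum_le_tsum
    (fun y => mul_le_mul_of_nonneg_right (hsq x y) (hK.kernel_nonneg x y)) (hrow x)) (by norm_num)

/-- The weak transport-information inequality, before taking squares. -/
theorem weakW2_le_energy {κ : ℝ} (hκ : 0 < κ) (hCDE : CDEprime K κ) {f : X → ℝ}
    (hf : IsDensity π f) :
    weakW2 (graphDist K) (fun x => f x * π x) π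
      ≤ ENNReal.ofReal (4 / (3 * κ)
          * √(4 * laziness K * energy K π (fun x => √(f x)) fun x => √(f x))) := by
  obtain ⟨D, hD⟩ := hK.exists_graphDist_le hκ hCDE
  have hJ := hK.laziness_nonneg
  set s : X → ℝ := fun x => √(f x) with hs
  have hssq : ∀ x, s x ^ 2 = f x := fun x => Real.sq_sqrt (hf.nonneg x)
  have hs0 : ∀ x, 0 ≤ s x := fun x => Real.sqrt_nonneg _
  set δ : ℕ → ℝ := fun n => 1 / ((n : ℝ) + 1) with hδ
  have hδ0 : ∀ n, 0 < δ n := fun n => by positivity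
  have hδ1 : ∀ n, δ n ≤ 1 := fun n => by
    rw [hδ]; simp only
    rw [div_le_one (by positivity)]
    linarith [(Nat.cast_nonneg n : (0 : ℝ) ≤ n)]
  -- Clamping is 1-Lipschitz, so it does not raise the energy; the normalised square of `v n` is a
  -- density bounded above and below.
  set v : ℕ → X → ℝ := fun n x => max (δ n) (min (s x) (n + 1)) with hv
  have hvδ : ∀ n x, δ n ≤ v n x := fun n x => le_max_left _ _
  have hv0 : ∀ n x, 0 < v n x := fun n x => (hδ0 n).trans_le (hvδ n x)
  have hvI : ∀ n x, v n x ∈ Set.Icc (δ n) (n + 1) := fun n x =>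
    ⟨hvδ n x, max_le ((hδ1 n).trans (by linarith [(Nat.cast_nonneg n : (0 : ℝ) ≤ n)]))
      (min_le_right _ _)⟩
  have hvb : ∀ n, Bdd (v n) := fun n => Bdd.of_mem_Icc (hvI n)
  have hvsq : ∀ n x, v n x ^ 2 ≤ 1 + f x := fun n x => by
    have e : v n x ≤ max 1 (s x) := max_le_max (hδ1 n) (min_le_left _ _)
    refine (pow_le_pow_left₀ (hv0 n x).le e 2).trans ?_
    rcases le_total 1 (s x) with h | h
    · rw [max_eq_right h, hssq]; linarith
    · rw [max_eq_left h]; linarith [hf.nonneg x]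
  have hlip : ∀ n x y, |v n y - v n x| ≤ |s y - s x| := fun n x y => by
    refine (abs_max_sub_max_le_max _ _ _ _).trans ?_
    rw [sub_self, abs_zero, max_eq_right (abs_nonneg _)]
    refine (abs_min_sub_min_le_max _ _ _ _).trans ?_
    rw [sub_self, abs_zero, max_eq_left (abs_nonneg _)]
  have hvlim : ∀ x, Tendsto (fun n => v n x) atTop (𝓝 (s x)) := by
    intro x
    have e1 : Tendsto δ atTop (𝓝 0) := tendsto_one_div_add_atTop_nhds_zero_nat
    have e2 : Tendsto (fun n : ℕ => min (s x) ((n : ℝ) + 1)) atTop (𝓝 (s x)) := by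
      refine tendsto_const_nhds.congr' ?_
      filter_upwards [eventually_ge_atTop ⌈s x⌉₊] with n hn
      rw [min_eq_left]
      linarith [Nat.ceil_le.1 hn]
    have := e1.max e2
    rwa [max_eq_right (hs0 x)] at this
  have hdom : Summable fun x => (1 + f x) * π x := by
    simpa only [add_mul, one_mul] using hK.prob_sum.summable.add hf.sum.summable
  set c : ℕ → ℝ := fun n => wsum π fun x => v n x ^ 2 with hc
  have hc0 : ∀ n, 0 < c n := fun n => by
    have := hK.isWeight_prob.wsum_mono (Bdd.const (δ n ^ 2)) (hvb n).sq fun x =>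
      pow_le_pow_left₀ (hδ0 n).le (hvδ n x) 2
    rw [wsum_const, hK.tsum_prob, mul_one] at this
    exact (pow_pos (hδ0 n) 2).trans_le this
  have hclim : Tendsto c atTop (𝓝 1) := by
    rw [← hf.sum.tsum_eq]
    refine tendsto_tsum_of_dominated_convergence hdom (fun x => ?_)
      (Eventually.of_forall fun n x => ?_)
    · rw [← hssq]
      exact ((hvlim x).pow 2).mul_const _
    · rw [Real.norm_of_nonneg (mul_nonneg (sq_nonneg _) (hK.prob_nonneg x))]
      exact mul_le_mul_of_nonneg_right (hvsq n x) (hK.prob_nonneg x)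
  have hcinv : Tendsto (fun n => (c n)⁻¹) atTop (𝓝 1) := by
    simpa using hclim.inv₀ one_ne_zero
  set g : ℕ → X → ℝ := fun n x => (c n)⁻¹ * v n x ^ 2 with hg
  have hgI : ∀ n x, g n x ∈ Set.Icc ((c n)⁻¹ * δ n ^ 2) ((c n)⁻¹ * ((n : ℝ) + 1) ^ 2) :=
    fun n x => ⟨mul_le_mul_of_nonneg_left (pow_le_pow_left₀ (hδ0 n).le (hvI n x).1 2)
        (inv_pos.2 (hc0 n)).le,
      mul_le_mul_of_nonneg_left (pow_le_pow_left₀ (hv0 n x).le (hvI n x).2 2)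
        (inv_pos.2 (hc0 n)).le⟩
  have hg0 : ∀ n x, 0 ≤ g n x := fun n x => mul_nonneg (inv_pos.2 (hc0 n)).le (sq_nonneg _)
  have hg1 : ∀ n, wsum π (g n) = 1 := fun n => by
    rw [hg]; simp only
    rw [wsum_const_mul]
    exact inv_mul_cancel₀ (hc0 n).ne'
  have hgs : ∀ n, HasSum (fun x => g n x * π x) 1 := fun n => by
    rw [← hg1 n]
    exact (hK.isWeight_prob.summable_mul (Bdd.of_mem_Icc (hgI n))).hasSum
  set E : ℝ := energy K π s s with hE
  have hgE : ∀ n, energy K π (fun x => √(g n x)) (fun x => √(g n x)) ≤ (c n)⁻¹ * E := by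
    intro n
    have e : (fun x => √(g n x)) = fun x => √((c n)⁻¹) * v n x := funext fun x => by
      rw [hg]; simp only
      rw [Real.sqrt_mul (inv_pos.2 (hc0 n)).le, Real.sqrt_sq (hv0 n x).le]
    rw [e, energy_const_mul_self, Real.sq_sqrt (inv_pos.2 (hc0 n)).le]
    exact mul_le_mul_of_nonneg_left (hK.energy_le_of_density hf (hvb n) (hlip n))
      (inv_pos.2 (hc0 n)).le
  have htv : Tendsto (fun n => ∑' x, |f x * π x - g n x * π x|) atTop (𝓝 0) := by
    have h0 : (0 : ℝ) = ∑' x : X, (0 : ℝ) := by simp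
    rw [h0]
    -- Eventually `(c n)⁻¹ < 2`, so `g n ≤ 2(1 + f)` and the difference with `f` is at most `3(1 +
    -- f)`.
    refine tendsto_tsum_of_dominated_convergence (bound := fun x => 3 * ((1 + f x) * π x))
      (hdom.mul_left 3) (fun x => ?_) ?_
    · have e1 : Tendsto (fun n => g n x) atTop (𝓝 (f x)) := by
        have := hcinv.mul ((hvlim x).pow 2)
        rwa [hssq, one_mul] at this
      have := ((e1.mul_const (π x)).const_sub (f x * π x)).abs
      simpa using this
    · filter_upwards [hcinv.eventually (gt_mem_nhds (by norm_num : (1 : ℝ) < 2))] with n hn x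
      rw [Real.norm_eq_abs, abs_abs, ← sub_mul, abs_mul, abs_of_nonneg (hK.prob_nonneg x),
        ← mul_assoc]
      refine mul_le_mul_of_nonneg_right ?_ (hK.prob_nonneg x)
      have e1 : g n x ≤ 2 * (1 + f x) :=
        mul_le_mul hn.le (hvsq n x) (sq_nonneg _) (by norm_num)
      rw [abs_le]
      constructor <;> linarith [hg0 n x, hf.nonneg x]
  have hbound : ∀ n, weakW2 (graphDist K) (fun x => f x * π x) π
      ≤ ENNReal.ofReal (D * √(∑' x, |f x * π x - g n x * π x|)
        + 4 / (3 * κ) * √(4 * laziness K * ((c n)⁻¹ * E))) := by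
    intro n
    rw [ENNReal.ofReal_add (by positivity) (by positivity)]
    refine (weakW2_triangle (ν₁ := fun x => g n x * π x) hK.graphDist_triangle
      (fun x => mul_nonneg (hf.nonneg x) (hK.prob_nonneg x)) hK.prob_nonneg).trans
      (add_le_add ?_ ?_)
    · exact weakW2_le_of_bounded graphDist_self hD
        (fun x => mul_nonneg (hf.nonneg x) (hK.prob_nonneg x))
        (fun x => mul_nonneg (hg0 n x) (hK.prob_nonneg x)) hf.sum (hgs n)
    · refine (hK.weakW2_le_of_bounded_density hκ hCDE
        (mul_pos (inv_pos.2 (hc0 n)) (pow_pos (hδ0 n) 2)) (hgI n) (hg1 n)).trans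
        (ENNReal.ofReal_le_ofReal ?_)
      refine mul_le_mul_of_nonneg_left (Real.sqrt_le_sqrt ?_) (by positivity)
      exact mul_le_mul_of_nonneg_left (hgE n) (by positivity)
  have hlim : Tendsto (fun n => D * √(∑' x, |f x * π x - g n x * π x|)
        + 4 / (3 * κ) * √(4 * laziness K * ((c n)⁻¹ * E))) atTop
      (𝓝 (D * √0 + 4 / (3 * κ) * √(4 * laziness K * (1 * E)))) :=
    (htv.sqrt.const_mul _).add ((((hcinv.mul_const E).const_mul _).sqrt).const_mul _)
  rw [Real.sqrt_zero, mul_zero, zero_add, one_mul] at hlim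
  exact ge_of_tendsto' (ENNReal.tendsto_ofReal hlim) hbound

end IsReversibleChain

end WeakTransport

theorem theorem1p3 {X : Type*} [Countable X] (K : X → X → ℝ) (π : X → ℝ)
    (hK : WeakTransport.IsReversibleChain K π) (κ : ℝ) (hκ : 0 < κ)
    (hCDE : WeakTransport.CDEprime K κ) :
    WeakTransport.WeakTransportInfo K π (κ / √2) ∧
    ∀ f : X → ℝ, WeakTransport.IsDensity π f →
      WeakTransport.weakW2 (WeakTransport.graphDist K) (fun x => f x * π x) π ^ 2
          ≤ ENNReal.ofReal
              (2 * WeakTransport.laziness K / κ ^ 2 * WeakTransport.fisherInfo K π f) ∧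
      2 * WeakTransport.laziness K / κ ^ 2 * WeakTransport.fisherInfo K π f
          ≤ 2 / κ ^ 2 * WeakTransport.fisherInfo K π f := by
  have hfisher : ∀ f : X → ℝ, WeakTransport.fisherInfo K π f
      = 4 * WeakTransport.energy K π (fun x => √(f x)) fun x => √(f x) := fun f => rfl
  have hmain : ∀ f : X → ℝ, WeakTransport.IsDensity π f →
      WeakTransport.weakW2 (WeakTransport.graphDist K) (fun x => f x * π x) π ^ 2
          ≤ ENNReal.ofReal
              (2 * WeakTransport.laziness K / κ ^ 2 * WeakTransport.fisherInfo K π f) ∧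
      2 * WeakTransport.laziness K / κ ^ 2 * WeakTransport.fisherInfo K π f
          ≤ 2 / κ ^ 2 * WeakTransport.fisherInfo K π f := by
    intro f hf
    have hE := hK.energy_nonneg fun x => √(f x)
    have hJ := hK.laziness_nonneg
    rw [hfisher]
    set E := WeakTransport.energy K π (fun x => √(f x)) fun x => √(f x)
    set J := WeakTransport.laziness K
    constructor
    · refine (pow_le_pow_left₀ zero_le (hK.weakW2_le_energy hκ hCDE hf) 2).trans ?_
      rw [← ENNReal.ofReal_pow (by positivity)]
      refine ENNReal.ofReal_le_ofReal ?_
      rw [mul_pow, Real.sq_sqrt (by positivity)]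
      -- The fixed-step loss enters here: `16/9` stays below the required `2`.
      have e1 : (4 / (3 * κ)) ^ 2 * (4 * J * E) = 16 / 9 * (4 * J * E / κ ^ 2) := by
        field_simp
        ring
      have e2 : 2 * J / κ ^ 2 * (4 * E) = 2 * (4 * J * E / κ ^ 2) := by ring
      rw [e1, e2]
      exact mul_le_mul_of_nonneg_right (by norm_num) (by positivity)
    · refine mul_le_mul_of_nonneg_right ?_ (by positivity)
      gcongr
      linarith [hK.laziness_le_one]
  refine ⟨fun f hf => ?_, hmain⟩
  have e : 1 / (κ / √2) ^ 2 = 2 / κ ^ 2 := by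
    rw [div_pow, Real.sq_sqrt (by norm_num), one_div_div]
  rw [e]
  exact (hmain f hf).1.trans (ENNReal.ofReal_le_ofReal (hmain f hf).2)
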